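/- Let $K$ be a field of characteristic different from $2$ and, for $k\ge 0$, let $\varepsilon_k$ be a primitive $2^k$-th root of unity in the algebraic closure $\bar K$. Assume $K\neq K(\varepsilon_2)$. The field $K$ is of type C if $\varepsilon_k+\varepsilon_k^{-1}\in K$ for every $k$; of type D with constant $m\ge 2$ if $\varepsilon_m+\varepsilon_m^{-1}\in K$, $\varepsilon_{m+1}+\varepsilon_{m+1}^{-1}\notin K$ and $\varepsilon_{m+1}-\varepsilon_{m+1}^{-1}\notin K$; of type E with constant $m\ge 3$ if $\varepsilon_m-\varepsilon_m^{-1}\in K$. Let $G=\langle g\rangle$ be a cyclic group of order $2^n$, and let $K_tG$ be a twisted group algebra of $G$ over $K$, that is, an associative unital $K$-algebra with a basis $\{\bar x\mid x\in G\}$ such that $\bar x\bar y=\gamma(x,y)\overline{xy}$ with $\gamma(x,y)\in K^*$. Let $a\in K^*$ be such that $\bar g^{2^n}=a$. Let $s=H_n(a)$ be the greatest integer in $[0,n]$ such that $a$ is a $2^s$-th power in $K(\varepsilon_2)$. A minimal idempotent is a nonzero idempotent $e$ such that the only idempotents $f$ with $fe=ef=f$ are $0$ and $e$. In each case below all coefficients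 lie in $K$, and the elements listed are pairwise distinct and are exactly the minimal idempotents of $K_tG$. Except in case 1), $b$ is any element of $K^*$ satisfying the stated equation, and $u_r=b^{-2^r}\bar g^{2^{n-s+r}}$, so that $u_r=(b^{-1}\bar g^{2^{n-s}})^{2^r}$. 1) If $s=0$: only $1$. 2) If $s\ge1$, $a=b^{2^s}$, and either $K$ is of type C, or $K$ is of type D or E and $s\le m-1$: $$e_0=\frac1{2^s}\sum_{j=0}^{2^s-1}u_0^j,\qquad e_{2^{s-1}}=\frac1{2^s}\sum_{j=0}^{2^s-1}(-1)^ju_0^j,$$ $$e_i=\frac1{2^s}\sum_{j=0}^{2^s-1}(\varepsilon_s^{ij}+\varepsilon_s^{-ij})u_0^j,\quad 1\le i\le 2^{s-1}-1.\tag{7}$$ 3) If $K$ is of type D or E, $s\ge m$ and $a=b^{2^s}$, with $\lambda=1$ for type D and $\lambda=-1$ for type E: $$e_0=\frac1{2^s}\sum_{j=0}^{2^s-1}u_0^j,\qquad e_{2^{m-2}}=\frac1{2^s}\sum_{j=0}^{2^s-1}(-1)^ju_0^j,$$ $$e_i=\frac1{2^s}\sum_{j=0}^{2^s-1}(\varepsilon_{m-1}^{ij}+\varepsilon_{m-1}^{-ij})u_0^j,\quad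 1\le i\le 2^{m-2}-1,\tag{8}$$ $$e_{ri}=\frac1{2^{s-r}}\sum_{j=0}^{2^{s-r}-1}(\varepsilon_m^{-j}\varepsilon_{m-2}^{-ij}+\lambda^{-j}\varepsilon_m^{j}\varepsilon_{m-2}^{ij})u_r^j,\quad 0\le r\le s-m,\ 0\le i\le 2^{m-2}-1.$$ 4) If $s\ge1$, $a=-b^{2^s}$, and either $K$ is of type C, or $K$ is of type D or E and $s\le m-1$, with $\lambda=-1$ if $K$ is of type E and $s=m-1$, and $\lambda=1$ otherwise: $$e_i=\frac1{2^s}\sum_{j=0}^{2^s-1}(\varepsilon_{s+1}^{-j}\varepsilon_{s-1}^{-ij}+\lambda^{-j}\varepsilon_{s+1}^{j}\varepsilon_{s-1}^{ij})u_0^j,\quad 0\le i\le 2^{s-1}-1.\tag{9}$$ 5) If $K$ is of type D, $s\ge m$ and $a=b^{2^s}(1+\varepsilon_m)^{2^s}$, where, if $s\ge m+2$, the roots of unity are chosen so that $\varepsilon_{m-2}=\varepsilon_m^4$: $$e_i=\frac1{2^s}\sum_{j=0}^{2^s-1}(1+\varepsilon_m)^{-j}(\varepsilon_{m-1}^{-ij}+\varepsilon_m^j\varepsilon_{m-1}^{ij})u_0^j,\quad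 0\le i\le 2^{m-1}-1;$$ if $s\ge m+1$, also $$e_{1,2^{m-1}-1}=\frac1{2^{s-1}}\sum_{j=0}^{2^{s-1}-1}(2+\varepsilon_m+\varepsilon_m^{-1})^{-j}u_1^j,$$ $$e_{1,2^{m-2}-1}=\frac1{2^{s-1}}\sum_{j=0}^{2^{s-1}-1}(-1)^j(2+\varepsilon_m+\varepsilon_m^{-1})^{-j}u_1^j,\tag{10}$$ $$e_{1,i}=\frac1{2^{s-1}}\sum_{j=0}^{2^{s-1}-1}(2+\varepsilon_m+\varepsilon_m^{-1})^{-j}(\varepsilon_{m-1}^{-j(1+i)}+\varepsilon_{m-1}^{j(1+i)})u_1^j,\quad 0\le i\le 2^{m-2}-2$$ (the last family is empty for $m=2$); and if $s\ge m+2$, also $$e_{ri}=\frac1{2^{s-r}}\sum_{j=0}^{2^{s-r}-1}(1+\varepsilon_m)^{-j2^r}(\varepsilon_m^{-j}\varepsilon_{m-2}^{-ij}+\varepsilon_m^{j}\varepsilon_{m-2}^{j(i+2^{r-2})})u_r^j,\quad 2\le r\le s-m,\ 0\le i\le 2^{m-2}-1.$$ -/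

import Mathlib

open IntermediateField

/-- A presentation of the `K`-algebra `A` as a twisted group algebra of the group `G` over `K`:
a `K`-basis `x̄` indexed by the elements `x` of `G`, with `x̄ * ȳ = γ (x, y) • (xy)̄` for scalars
`γ (x, y)` in `Kˣ`. -/
structure TwistedGroupAlgebra (K G A : Type*) [Field K] [Group G] [Ring A] [Algebra K A] where
  /-- The basis `x ↦ x̄`. -/
  bar : Module.Basis G K A
  /-- The factor system. -/
  γ : G → G → Kˣ
  bar_mul_bar : ∀ x y : G, bar x * bar y = (γ x y : K) • bar (x * y)

/-- `e` is a minimal idempotent: it is minimal among the nonzero idempotents for the order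
`f ≤ e ↔ f * e = f ∧ e * f = f`. -/
def IsMinimalIdempotent {A : Type*} [Ring A] (e : A) : Prop :=
  IsIdempotentElem e ∧ e ≠ 0 ∧
    ∀ f : A, IsIdempotentElem f → f * e = f → e * f = f → f = 0 ∨ f = e

/-- The members of `M` are pairwise distinct, and they are exactly the minimal idempotents
of `A`. -/
def ListsMinimalIdempotents {A : Type*} [Ring A] (M : Multiset A) : Prop :=
  M.Nodup ∧ ∀ e : A, e ∈ M ↔ IsMinimalIdempotent e

section

variable {K : Type*} [Field K]

/-- The element `x` of the algebraic closure of `K` lies in `K`. -/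
def InBase (x : AlgebraicClosure K) : Prop :=
  x ∈ Set.range (algebraMap K (AlgebraicClosure K))

/-- `K` is of type C. Here and below, `ε k` is a primitive `2 ^ k`-th root of unity in the
algebraic closure of `K`. -/
def IsTypeC (ε : ℕ → AlgebraicClosure K) : Prop :=
  K⟮ε 2⟯ ≠ ⊥ ∧ ∀ k : ℕ, InBase (ε k + (ε k)⁻¹)

/-- `K` is of type D, with constant `m`. -/
def IsTypeD (ε : ℕ → AlgebraicClosure K) (m : ℕ) : Prop :=
  K⟮ε 2⟯ ≠ ⊥ ∧ 2 ≤ m ∧ InBase (ε m + (ε m)⁻¹) ∧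
    ¬ InBase (ε (m + 1) + (ε (m + 1))⁻¹) ∧ ¬ InBase (ε (m + 1) - (ε (m + 1))⁻¹)

/-- `K` is of type E, with constant `m`. -/
def IsTypeE (ε : ℕ → AlgebraicClosure K) (m : ℕ) : Prop :=
  K⟮ε 2⟯ ≠ ⊥ ∧ 3 ≤ m ∧ InBase (ε m - (ε m)⁻¹)

/-- The set `Kₛ` of those `a` in `Kˣ` that are `2 ^ s`-th powers in `K(ε₂)`. -/
def powersInQuadratic (ε : ℕ → AlgebraicClosure K) (s : ℕ) : Set Kˣ :=
  {a | ∃ α : K⟮ε 2⟯, α ^ 2 ^ s = algebraMap K K⟮ε 2⟯ (a : K)}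

/-- `H_n(a) = s`: the integer `s` is the greatest one in `[0, n]` with `a ∈ Kₛ`. -/
def HeightEq (ε : ℕ → AlgebraicClosure K) (n : ℕ) (a : Kˣ) (s : ℕ) : Prop :=
  IsGreatest {t : ℕ | t ≤ n ∧ a ∈ powersInQuadratic ε t} s

open Classical in
/-- The sign `λ`: it is `-1` if `K` is of type E with constant `m`, and `1` otherwise. -/
noncomputable def typeSign (ε : ℕ → AlgebraicClosure K) (m : ℕ) : AlgebraicClosure K :=
  if IsTypeE ε m then -1 else 1

/-- The element `(1 / 2 ^ N) ∑ c j u ^ j`, with `j` running from `0` to `2 ^ N - 1`. -/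
noncomputable def dyadicMean {A : Type*} [Ring A] [Algebra K A] (N : ℕ) (c : ℕ → K) (u : A) : A :=
  ((2 : K) ^ N)⁻¹ • ∑ j ∈ Finset.range (2 ^ N), c j • u ^ j

/-- The element `b ^ (-2 ^ r) * x ^ (2 ^ (k + r))`. -/
noncomputable def scaledPow {A : Type*} [Ring A] [Algebra K A] (b : Kˣ) (x : A) (k r : ℕ) : A :=
  ((b : K)⁻¹ ^ 2 ^ r) • x ^ 2 ^ (k + r)

end

/-!
Let `x` be the basis element of the generator. The powers of `x` form a basis, so `A` is
`K[X] / (X ^ (2 ^ n) - a)`, and since `2 ≠ 0` and `a ≠ 0` this polynomial is separable. Hence the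
homomorphisms `ψ` from `A` to the algebraic closure of `K` correspond to the roots of the polynomial
and separate the points of `A`. An idempotent is the indicator of a Galois-stable set of
homomorphisms, and the minimal idempotents are the indicators of the Galois orbits
(`ListsOrbits.listsMinimalIdempotents`). The theorem therefore amounts to showing that the listed
elements are the indicators of the orbits, each listed once.

The values of `u_r = b ^ (-2 ^ r) * x ^ (2 ^ (n - s + r))` all have the same `2 ^ (s - r)`-th power.
Let `α ∈ K(ε 2)` be one of them, and let `τ` be conjugation on `K(ε 2)`. By orthogonality of
characters, the mean with coefficients `α ^ (-j) + (τ α) ^ (-j)` (or `α ^ (-j)`, if `α ∈ K`) is the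
indicator of the set of `ψ` with `ψ u_r ∈ {α, τ α}`. This set is one orbit if
`X ^ (2 ^ k) - b ^ (2 ^ r) * α`, with `k = n - s + r`, is irreducible over `K(ε 2)`. As `-1` is a
square there, this only requires, for `k > 0`, that `b ^ (2 ^ r) * α` is not a square
(`irreducible_X_pow_two_pow_sub_C`); for `r = 0` this is the maximality of `s`, and for `r > 0` it
holds because `α` is not a square (`HeightEq.eq_zero_or_nonsquare`,
`IsPureGenerator.isOrbitIndicator_pair`).

What remains is arithmetic of roots of unity in `K(ε 2)`. The type of `K` determines how `τ` acts
on them, and in types D and E no primitive root of order `2 ^ m` is a square in `K(ε 2)`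
(`IsTypeD.primitiveRootsNonsquare`, `IsTypeE.primitiveRootsNonsquare`). Two families of values
cover all cases: the multiples of some `κ ∈ K` by the roots of unity of order dividing `2 ^ M`, on
which `τ` acts by inversion (`IsPureGenerator.listsOrbits_roots`), and the multiples of some
`β ∈ K(ε 2)` by the roots of order dividing `2 ^ (N + 1)`, where `τ` interchanges the two cosets of
the subgroup of index two (`IsPureGenerator.listsOrbits_coset`). The families with different `r`
are separated by the order of the root of unity that occurs in the value of `u_0`.
-/

/-! ### Idempotents and Galois orbits of homomorphisms to the algebraic closure -/

section Orbits

variable {K A : Type*} [Field K] [Ring A] [Algebra K A]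

/-- The homomorphisms from `A` to the algebraic closure of `K` separate the elements of `A`. -/
def SeparatesPoints (K A : Type*) [Field K] [Ring A] [Algebra K A] : Prop :=
  ∀ e f : A, (∀ ψ : A →ₐ[K] AlgebraicClosure K, ψ e = ψ f) → e = f

/-- Under every homomorphism `ψ` from `A` to the algebraic closure of `K`, the element `e` takes
the value `1` or `0` according to whether `ψ ∈ Q`, and `Q` is a single Galois orbit. -/
structure IsOrbitIndicator (e : A) (Q : Set (A →ₐ[K] AlgebraicClosure K)) : Prop where
  nonempty : Q.Nonempty
  apply_of_mem : ∀ ψ ∈ Q, ψ e = 1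
  apply_of_notMem : ∀ ψ ∉ Q, ψ e = 0
  conj : ∀ ψ ∈ Q, ∀ ψ' ∈ Q, ∃ σ : AlgebraicClosure K ≃ₐ[K] AlgebraicClosure K,
    ∀ y, σ (ψ y) = ψ' y

/-- The members of `M` are the indicators of Galois orbits partitioning `P`, each listed once. -/
structure ListsOrbits (M : Multiset A) (P : Set (A →ₐ[K] AlgebraicClosure K)) : Prop where
  nodup : M.Nodup
  indicator : ∀ e ∈ M, ∃ Q ⊆ P, IsOrbitIndicator e Q
  cover : ∀ ψ ∈ P, ∃ e ∈ M, ψ e = 1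

theorem IsOrbitIndicator.listsOrbits_singleton {e : A}
    {Q : Set (A →ₐ[K] AlgebraicClosure K)} (h : IsOrbitIndicator e Q) : ListsOrbits {e} Q where
  nodup := Multiset.nodup_singleton e
  indicator f hf := by
    rw [Multiset.mem_singleton] at hf
    exact ⟨Q, subset_rfl, hf ▸ h⟩
  cover ψ hψ := ⟨e, Multiset.mem_singleton_self e, h.apply_of_mem ψ hψ⟩

/-- A common member would take the value `1` somewhere on `P` and vanish off `Q`. -/
theorem ListsOrbits.disjoint {M N : Multiset A} {P Q : Set (A →ₐ[K] AlgebraicClosure K)}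
    (hM : ListsOrbits M P) (hN : ListsOrbits N Q) (h : Disjoint P Q) : Disjoint M N := by
  rw [Multiset.disjoint_left]
  intro e he he'
  obtain ⟨S, hSP, hS⟩ := hM.indicator e he
  obtain ⟨S', hSQ, hS'⟩ := hN.indicator e he'
  obtain ⟨ψ, hψ⟩ := hS.nonempty
  have h1 := hS.apply_of_mem ψ hψ
  rw [hS'.apply_of_notMem ψ fun h' => Set.disjoint_left.1 h (hSP hψ) (hSQ h')] at h1
  exact zero_ne_one h1

theorem ListsOrbits.add {M N : Multiset A} {P Q : Set (A →ₐ[K] AlgebraicClosure K)}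
    (hM : ListsOrbits M P) (hN : ListsOrbits N Q) (h : Disjoint P Q) :
    ListsOrbits (M + N) (P ∪ Q) where
  nodup := Multiset.nodup_add.2 ⟨hM.nodup, hN.nodup, hM.disjoint hN h⟩
  indicator e he := by
    rcases Multiset.mem_add.1 he with he | he
    · obtain ⟨S, hS, hS'⟩ := hM.indicator e he
      exact ⟨S, hS.trans Set.subset_union_left, hS'⟩
    · obtain ⟨S, hS, hS'⟩ := hN.indicator e he
      exact ⟨S, hS.trans Set.subset_union_right, hS'⟩
  cover ψ hψ := by
    rcases hψ with hψ | hψ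
    · obtain ⟨e, he, h1⟩ := hM.cover ψ hψ
      exact ⟨e, Multiset.mem_add.2 (Or.inl he), h1⟩
    · obtain ⟨e, he, h1⟩ := hN.cover ψ hψ
      exact ⟨e, Multiset.mem_add.2 (Or.inr he), h1⟩

theorem ListsOrbits.bind {ι : Type*} {I : Finset ι} {M : ι → Multiset A}
    {P : ι → Set (A →ₐ[K] AlgebraicClosure K)} (hM : ∀ i ∈ I, ListsOrbits (M i) (P i))
    (h : ∀ i ∈ I, ∀ j ∈ I, i ≠ j → Disjoint (P i) (P j)) :
    ListsOrbits (I.val.bind M) {ψ | ∃ i ∈ I, ψ ∈ P i} where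
  nodup := by
    refine Multiset.nodup_bind.2 ⟨fun i hi => (hM i hi).nodup, ?_⟩
    refine Multiset.Nodup.pairwise (fun i hi j hj hij => ?_) I.nodup
    exact (hM i hi).disjoint (hM j hj) (h i hi j hj hij)
  indicator e he := by
    obtain ⟨i, hi, he⟩ := Multiset.mem_bind.1 he
    obtain ⟨S, hS, hS'⟩ := (hM i hi).indicator e he
    exact ⟨S, fun ψ hψ => ⟨i, hi, hS hψ⟩, hS'⟩
  cover ψ hψ := by
    obtain ⟨i, hi, hψ⟩ := hψ
    obtain ⟨e, he, h1⟩ := (hM i hi).cover ψ hψ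
    exact ⟨e, Multiset.mem_bind.2 ⟨i, hi, he⟩, h1⟩

theorem ListsOrbits.map {ι : Type*} {I : Finset ι} {e : ι → A}
    {P : ι → Set (A →ₐ[K] AlgebraicClosure K)} (hM : ∀ i ∈ I, IsOrbitIndicator (e i) (P i))
    (h : ∀ i ∈ I, ∀ j ∈ I, i ≠ j → Disjoint (P i) (P j)) :
    ListsOrbits (I.val.map e) {ψ | ∃ i ∈ I, ψ ∈ P i} := by
  rw [← Multiset.bind_singleton]
  exact ListsOrbits.bind (fun i hi => (hM i hi).listsOrbits_singleton) h

theorem ListsOrbits.congr {M N : Multiset A} {P Q : Set (A →ₐ[K] AlgebraicClosure K)}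
    (hM : ListsOrbits M P) (hMN : M = N) (h : ∀ ψ, ψ ∈ P ↔ ψ ∈ Q) : ListsOrbits N Q := by
  rw [← hMN, ← Set.ext h]
  exact hM

theorem listsOrbits_zero_empty :
    ListsOrbits (0 : Multiset A) (∅ : Set (A →ₐ[K] AlgebraicClosure K)) where
  nodup := Multiset.nodup_zero
  indicator e he := absurd he (Multiset.notMem_zero e)
  cover ψ hψ := absurd hψ (Set.notMem_empty ψ)

theorem IsOrbitIndicator.isIdempotentElem (hA : SeparatesPoints K A) {e : A}
    {Q : Set (A →ₐ[K] AlgebraicClosure K)} (h : IsOrbitIndicator e Q) : IsIdempotentElem e := by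
  refine hA _ _ fun ψ => ?_
  by_cases hψ : ψ ∈ Q
  · simp [h.apply_of_mem ψ hψ]
  · simp [h.apply_of_notMem ψ hψ]

/-- An idempotent takes Galois-conjugate values, so the set where it is `1` is a union of
orbits. -/
theorem IsOrbitIndicator.isMinimalIdempotent (hA : SeparatesPoints K A) {e : A}
    {Q : Set (A →ₐ[K] AlgebraicClosure K)} (h : IsOrbitIndicator e Q) :
    IsMinimalIdempotent e := by
  refine ⟨h.isIdempotentElem hA, ?_, fun f hf hfe _ => ?_⟩
  · rintro rfl
    obtain ⟨ψ, hψ⟩ := h.nonempty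
    simpa using h.apply_of_mem ψ hψ
  · have hout : ∀ ψ ∉ Q, ψ f = 0 := fun ψ hψ => by
      rw [← hfe, map_mul, h.apply_of_notMem ψ hψ, mul_zero]
    by_cases hne : ∃ ψ ∈ Q, ψ f ≠ 0
    · obtain ⟨ψ, hψ, hψf⟩ := hne
      have h1 : ψ f = 1 := by
        have : ψ f * ψ f = ψ f := by rw [← map_mul, hf.eq]
        exact mul_left_cancel₀ hψf (by rw [this, mul_one])
      right
      refine hA _ _ fun ψ' => ?_
      by_cases hψ' : ψ' ∈ Q
      · obtain ⟨σ, hσ⟩ := h.conj ψ hψ ψ' hψ'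
        rw [← hσ, h1, map_one, h.apply_of_mem ψ' hψ']
      · rw [hout ψ' hψ', h.apply_of_notMem ψ' hψ']
    · left
      refine hA _ _ fun ψ => ?_
      rw [map_zero]
      by_cases hψ : ψ ∈ Q
      · by_contra hc
        exact hne ⟨ψ, hψ, hc⟩
      · exact hout ψ hψ

theorem ListsOrbits.listsMinimalIdempotents (hA : SeparatesPoints K A) {M : Multiset A}
    (h : ListsOrbits M (Set.univ : Set (A →ₐ[K] AlgebraicClosure K))) :
    ListsMinimalIdempotents M := by
  have hcomm : ∀ e f : A, e * f = f * e := fun e f =>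
    hA _ _ fun ψ => by rw [map_mul, map_mul, mul_comm]
  refine ⟨h.nodup, fun e => ⟨fun he => ?_, fun he => ?_⟩⟩
  · obtain ⟨Q, -, hQ⟩ := h.indicator e he
    exact hQ.isMinimalIdempotent hA
  · obtain ⟨he1, he0, hmin⟩ := he
    obtain ⟨ψ, hψ⟩ : ∃ ψ : A →ₐ[K] AlgebraicClosure K, ψ e ≠ 0 := by
      by_contra! hc
      exact he0 (hA _ _ fun ψ => by rw [hc ψ, map_zero])
    obtain ⟨f, hf, hψf⟩ := h.cover ψ trivial
    obtain ⟨Q, -, hQ⟩ := h.indicator f hf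
    obtain ⟨hf1, -, hfmin⟩ := hQ.isMinimalIdempotent hA
    have hfe : f * e ≠ 0 := fun hc => hψ (by
      have := map_mul ψ f e
      rwa [hc, map_zero, hψf, one_mul, eq_comm] at this)
    have hidem : IsIdempotentElem (f * e) :=
      IsIdempotentElem.mul_of_commute (hcomm f e) hf1 he1
    -- the nonzero idempotent `f * e` lies below both minimal idempotents `e` and `f`
    have h1 : f * e = e := (hmin _ hidem (by rw [mul_assoc, he1.eq])
      (by rw [hcomm f e, ← mul_assoc, he1.eq])).resolve_left hfe
    have h2 : f * e = f := (hfmin _ hidem (by rw [hcomm f e, mul_assoc, hf1.eq])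
      (by rw [← mul_assoc, hf1.eq])).resolve_left hfe
    rw [← h1, h2]
    exact hf

end Orbits

/-! ### Binomial extensions of `2`-power degree -/

section Binomial

open Polynomial

/-- By induction on `k`: over a field containing a square root of `-1`, a square root of a nonsquare
is again a nonsquare in the quadratic extension that it generates. -/
theorem irreducible_X_pow_two_pow_sub_C {F : Type*} [Field F] (h2 : (2 : F) ≠ 0) {i : F}
    (hi : i ^ 2 = -1) {c : F} (hc : ∀ y, y ^ 2 ≠ c) (k : ℕ) :
    Irreducible (X ^ 2 ^ k - C c : F[X]) := by
  induction k generalizing F with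
  | zero => simpa using irreducible_X_sub_C c
  | succ k ih =>
    rw [pow_succ]
    have hirr := X_pow_sub_C_irreducible_of_prime Nat.prime_two hc
    refine X_pow_mul_sub_C_irreducible hirr fun E _ _ x hx => ?_
    have hint : IsIntegral F x := by
      by_contra hn
      rw [minpoly.eq_zero hn] at hx
      exact hirr.ne_zero hx.symm
    set z := AdjoinSimple.gen F x with hz
    have hz2 : z ^ 2 = algebraMap F F⟮x⟯ c := by
      have h := minpoly.aeval F x
      rw [hx] at h
      apply (algebraMap F⟮x⟯ E).injective
      rw [map_pow, AdjoinSimple.algebraMap_gen, ← IsScalarTower.algebraMap_apply]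
      simpa [sub_eq_zero] using h
    refine ih (i := algebraMap F F⟮x⟯ i) (fun h => h2 ?_) (by rw [← map_pow, hi]; simp)
      fun y hy => ?_
    · exact (algebraMap F F⟮x⟯).injective (by rw [map_ofNat, map_zero]; exact h)
    -- a square root `y = p + q z` of `z` gives `c = (i p / q) ^ 2`
    have hdim : (adjoin.powerBasis hint).dim = 2 := by
      rw [adjoin.powerBasis_dim, hx, natDegree_X_pow_sub_C]
    obtain ⟨f, hf, hyf⟩ := (adjoin.powerBasis hint).exists_eq_aeval y
    rw [hdim] at hf
    obtain ⟨q, p, rfl⟩ := exists_eq_X_add_C_of_natDegree_le_one (Nat.lt_succ_iff.1 hf)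
    rw [adjoin.powerBasis_gen, ← hz] at hyf
    simp only [map_add, map_mul, aeval_C, aeval_X] at hyf
    have hli : ∀ u v : F, algebraMap F F⟮x⟯ u + algebraMap F F⟮x⟯ v * z = 0 → v = 0 := by
      intro u v huv
      by_contra hv
      refine hc (-u / v) ?_
      have hv' : algebraMap F F⟮x⟯ v ≠ 0 := by simpa using hv
      apply (algebraMap F F⟮x⟯).injective
      rw [← hz2, map_pow, map_div₀, map_neg]
      congr 1
      field_simp
      linear_combination -huv
    have hexp : algebraMap F F⟮x⟯ (p ^ 2 + q ^ 2 * c) +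
        algebraMap F F⟮x⟯ (2 * p * q - 1) * z = 0 := by
      rw [hyf] at hy
      simp only [map_add, map_mul, map_pow, map_sub, map_one, map_ofNat]
      linear_combination hy - (algebraMap F F⟮x⟯ q) ^ 2 * hz2
    have h1 := hli _ _ hexp
    rw [h1, map_zero, zero_mul, add_zero, map_eq_zero] at hexp
    have hq : q ≠ 0 := by
      rintro rfl
      simp at h1
    refine hc (i * p / q) ?_
    field_simp
    linear_combination p ^ 2 * hi - hexp

end Binomial

/-! ### The twisted group algebra of a cyclic group -/

section Pure

open Polynomial

variable {K G A : Type*} [Field K] [Group G] [Ring A] [Algebra K A]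

theorem TwistedGroupAlgebra.exists_smul_bar_pow (T : TwistedGroupAlgebra K G A) (g : G) (i : ℕ) :
    ∃ u : Kˣ, T.bar (g ^ (i + 1)) = (u : K) • T.bar g ^ (i + 1) := by
  induction i with
  | zero => exact ⟨1, by simp⟩
  | succ i ih =>
    obtain ⟨u, hu⟩ := ih
    refine ⟨(T.γ (g ^ (i + 1)) g)⁻¹ * u, ?_⟩
    have h := T.bar_mul_bar (g ^ (i + 1)) g
    rw [← pow_succ, hu, smul_mul_assoc, ← pow_succ] at h
    rw [Units.val_mul, mul_smul, h, smul_smul, Units.inv_mul, one_smul]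

/-- The powers `1, x, …, x ^ (N - 1)` of the generator `x` are a basis of the twisted group algebra
of a cyclic group of order `N`. -/
theorem TwistedGroupAlgebra.exists_powerBasis (T : TwistedGroupAlgebra K G A) {g : G}
    (hg : ∀ x : G, x ∈ Subgroup.zpowers g) {N : ℕ} (hN : N ≠ 0) (hG : Nat.card G = N) {a : K}
    (ha : T.bar g ^ N = algebraMap K A a) :
    ∃ pb : PowerBasis K A, pb.gen = T.bar g ∧ pb.dim = N := by
  have : Finite G := Nat.finite_of_card_ne_zero (by rw [hG]; exact hN)
  have : Fintype G := Fintype.ofFinite G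
  have hspan : ⊤ ≤ Submodule.span K (Set.range fun i : Fin N => T.bar g ^ (i : ℕ)) := by
    rw [← T.bar.span_eq, Submodule.span_le]
    rintro _ ⟨y, rfl⟩
    obtain ⟨j, hj⟩ := Submonoid.mem_powers_iff _ _ |>.1 (mem_powers_iff_mem_zpowers.2 (hg y))
    -- a positive exponent of `g` representing `y`, as `T.bar 1` need not be `1`
    obtain ⟨i, hi⟩ : ∃ i, g ^ (i + 1) = y := by
      refine ⟨j + (N - 1), ?_⟩
      rw [add_assoc, Nat.sub_add_cancel (Nat.one_le_iff_ne_zero.2 hN), pow_add, hj, ← hG,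
        pow_card_eq_one', mul_one]
    obtain ⟨u, hu⟩ := T.exists_smul_bar_pow g i
    rw [← hi, hu, ← Nat.div_add_mod (i + 1) N, pow_add, pow_mul, ha, ← map_pow, ← Algebra.smul_def,
      smul_smul]
    exact Submodule.smul_mem _ _ (Submodule.subset_span
      ⟨⟨(i + 1) % N, Nat.mod_lt _ (Nat.pos_of_ne_zero hN)⟩, rfl⟩)
  have hcard : Fintype.card (Fin N) = Module.finrank K A := by
    rw [Module.finrank_eq_card_basis T.bar, Fintype.card_fin, ← Nat.card_eq_fintype_card, hG]
  exact ⟨⟨T.bar g, N, basisOfTopLeSpanOfCardEqFinrank _ hspan hcard, by simp⟩, rfl, rfl⟩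

/-- `A` is generated over `K` by `x`, subject to the single separable equation `x ^ N = a`: the
homomorphisms from `A` to the algebraic closure of `K` correspond to the roots of this equation,
and they separate points. -/
structure IsPureGenerator (x : A) (N : ℕ) (a : K) : Prop where
  pow_eq : x ^ N = algebraMap K A a
  separates : SeparatesPoints K A
  exists_hom : ∀ ξ : AlgebraicClosure K, ξ ^ N = algebraMap K _ a →
    ∃ ψ : A →ₐ[K] AlgebraicClosure K, ψ x = ξ
  hom_ext : ∀ ψ ψ' : A →ₐ[K] AlgebraicClosure K, ψ x = ψ' x → ψ = ψ'

theorem PowerBasis.isPureGenerator (pb : PowerBasis K A) {N : ℕ} (hN : (N : K) ≠ 0) {a : K}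
    (ha0 : a ≠ 0) (hdim : pb.dim = N) (ha : pb.gen ^ N = algebraMap K A a) :
    IsPureGenerator pb.gen N a := by
  have hN0 : N ≠ 0 := by
    rintro rfl
    simp at hN
  have : Nontrivial A := by
    have : Nonempty (Fin pb.dim) := ⟨⟨0, by omega⟩⟩
    exact pb.basis.repr.toEquiv.nontrivial
  have hmin : minpoly K pb.gen = X ^ N - C a := by
    have hdvd : minpoly K pb.gen ∣ X ^ N - C a := minpoly.dvd _ _ (by simp [ha])
    refine (eq_of_monic_of_dvd_of_natDegree_le (minpoly.monic pb.isIntegral_gen)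
      (monic_X_pow_sub_C a hN0) hdvd ?_).symm
    rw [natDegree_X_pow_sub_C, pb.natDegree_minpoly, hdim]
  have hex : ∀ ξ : AlgebraicClosure K, ξ ^ N = algebraMap K _ a →
      ∃ ψ : A →ₐ[K] AlgebraicClosure K, ψ pb.gen = ξ := fun ξ hξ =>
    ⟨pb.lift ξ (by simp [hmin, hξ]), pb.lift_gen _ _⟩
  refine ⟨ha, fun e f hef => ?_, hex, fun ψ ψ' h => pb.algHom_ext h⟩
  -- a polynomial of degree less than `N` is determined by its values at the `N` roots
  obtain ⟨p, hp, hpe⟩ := pb.exists_eq_aeval (e - f)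
  have hsep : (X ^ N - C a : K[X]).Separable := separable_X_pow_sub_C a hN ha0
  have hcard := card_rootSet_eq_natDegree (K := AlgebraicClosure K) hsep
    (IsAlgClosed.splits _)
  have hp0 : p = 0 := by
    by_contra hp0
    have hsub : (X ^ N - C a : K[X]).rootSet (AlgebraicClosure K) ⊆
        p.rootSet (AlgebraicClosure K) := by
      intro ξ hξ
      rw [mem_rootSet] at hξ ⊢
      obtain ⟨ψ, hψ⟩ := hex ξ (by simpa [sub_eq_zero] using hξ.2)
      refine ⟨hp0, ?_⟩
      rw [← hψ, aeval_algHom_apply, ← hpe, map_sub, hef, sub_self]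
    have h1 := Set.ncard_le_ncard hsub (rootSet_finite _ _)
    have h2 := p.ncard_rootSet_le (AlgebraicClosure K)
    rw [← Nat.card_eq_fintype_card, Nat.card_coe_set_eq, natDegree_X_pow_sub_C] at hcard
    omega
  rw [hp0, map_zero] at hpe
  exact sub_eq_zero.1 hpe

end Pure

/-! ### The quadratic extension obtained by adjoining a square root of `-1` -/

section Quadratic

variable {K : Type*} [Field K]

/-- `ι` is a square root of `-1` outside `K`, and the automorphism `τ` of the algebraic closure
restricts to the nontrivial automorphism of `K(ι)` over `K`. -/
structure IsQuadraticConj (ι : AlgebraicClosure K)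
    (τ : AlgebraicClosure K ≃ₐ[K] AlgebraicClosure K) : Prop where
  sq : ι ^ 2 = -1
  notInBase : ¬ InBase ι
  map_mem : ∀ y ∈ K⟮ι⟯, τ y ∈ K⟮ι⟯
  map_map : ∀ y ∈ K⟮ι⟯, τ (τ y) = y
  inBase : ∀ y ∈ K⟮ι⟯, τ y = y → InBase y

theorem algebraicClosure_two_ne_zero (h2 : (2 : K) ≠ 0) : (2 : AlgebraicClosure K) ≠ 0 := by
  rw [← map_ofNat (algebraMap K (AlgebraicClosure K)) 2]
  simpa using h2

theorem mem_adjoin_sqrt_neg_one {ι : AlgebraicClosure K} (hι : ι ^ 2 = -1)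
    {y : AlgebraicClosure K} (hy : y ∈ K⟮ι⟯) :
    ∃ p q : K, y = algebraMap K _ p + algebraMap K _ q * ι := by
  have hint : IsIntegral K ι := Algebra.IsIntegral.isIntegral ι
  obtain ⟨f, hf, hyf⟩ := (adjoin.powerBasis hint).exists_eq_aeval (⟨y, hy⟩ : K⟮ι⟯)
  have hdeg : (minpoly K ι).natDegree ≤ 2 := by
    have hdvd : minpoly K ι ∣ (Polynomial.X ^ 2 - Polynomial.C (-1) : Polynomial K) :=
      minpoly.dvd _ _ (by simp [hι])
    have := Polynomial.natDegree_le_of_dvd hdvd (Polynomial.X_pow_sub_C_ne_zero two_pos _)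
    rwa [Polynomial.natDegree_X_pow_sub_C] at this
  rw [adjoin.powerBasis_dim] at hf
  obtain ⟨q, p, rfl⟩ := Polynomial.exists_eq_X_add_C_of_natDegree_le_one
    (Nat.lt_succ_iff.1 (hf.trans_le hdeg))
  refine ⟨p, q, ?_⟩
  have h := congrArg (algebraMap K⟮ι⟯ (AlgebraicClosure K)) hyf
  rw [← Polynomial.aeval_algebraMap_apply, adjoin.powerBasis_gen, AdjoinSimple.algebraMap_gen] at h
  simp only [map_add, map_mul, Polynomial.aeval_C, Polynomial.aeval_X] at h
  rw [add_comm]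
  exact h

theorem exists_isQuadraticConj (h2 : (2 : K) ≠ 0) {ι : AlgebraicClosure K} (hι : ι ^ 2 = -1)
    (hK : K⟮ι⟯ ≠ ⊥) : ∃ τ, IsQuadraticConj ι τ := by
  have hnb : ¬ InBase ι := fun h =>
    hK (adjoin_simple_eq_bot_iff.2 (by simpa [InBase, mem_bot] using h))
  have hmin : minpoly K ι = Polynomial.X ^ 2 - Polynomial.C (-1) := by
    refine (minpoly.eq_of_irreducible_of_monic ?_ (by simp [hι])
      (Polynomial.monic_X_pow_sub_C _ two_ne_zero)).symm
    refine X_pow_sub_C_irreducible_of_prime Nat.prime_two fun y hy => hnb ?_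
    have h : (algebraMap K (AlgebraicClosure K) y) ^ 2 = ι ^ 2 := by rw [← map_pow, hy, hι]; simp
    rcases sq_eq_sq_iff_eq_or_eq_neg.1 h with h | h
    · exact ⟨y, h⟩
    · exact ⟨-y, by rw [map_neg, h, neg_neg]⟩
  have hconj : IsConjRoot K ι (-ι) :=
    isConjRoot_of_aeval_eq_zero (Algebra.IsIntegral.isIntegral ι) (by simp [hmin, hι])
  obtain ⟨τ, hτ⟩ := isConjRoot_iff_exists_algEquiv.1 hconj.symm
  refine ⟨τ, hι, hnb, fun y hy => ?_, fun y hy => ?_, fun y hy h => ?_⟩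
  · obtain ⟨p, q, rfl⟩ := mem_adjoin_sqrt_neg_one hι hy
    rw [map_add, map_mul, AlgEquiv.commutes, AlgEquiv.commutes, hτ]
    exact add_mem (_root_.algebraMap_mem _ _)
      (mul_mem (_root_.algebraMap_mem _ _) (neg_mem (mem_adjoin_simple_self K ι)))
  · obtain ⟨p, q, rfl⟩ := mem_adjoin_sqrt_neg_one hι hy
    simp [hτ]
  · obtain ⟨p, q, rfl⟩ := mem_adjoin_sqrt_neg_one hι hy
    rw [map_add, map_mul, AlgEquiv.commutes, AlgEquiv.commutes, hτ] at h
    have hι0 : ι ≠ 0 := by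
      rintro rfl
      simp at hι
    have h0 : algebraMap K (AlgebraicClosure K) q = 0 := by
      have : 2 * (algebraMap K (AlgebraicClosure K) q * ι) = 0 := by linear_combination -h
      simpa [algebraicClosure_two_ne_zero h2, hι0] using this
    exact ⟨p, by rw [h0]; ring⟩

variable {ι : AlgebraicClosure K} {τ : AlgebraicClosure K ≃ₐ[K] AlgebraicClosure K}

theorem IsQuadraticConj.ne_of_sq (hτ : IsQuadraticConj ι τ) {y : AlgebraicClosure K}
    (hy : y ^ 2 = -1) : ¬ InBase y := by
  rintro ⟨p, rfl⟩
  rw [← hτ.sq] at hy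
  rcases sq_eq_sq_iff_eq_or_eq_neg.1 hy with h | h
  · exact hτ.notInBase ⟨p, h⟩
  · exact hτ.notInBase ⟨-p, by rw [map_neg, h, neg_neg]⟩

/-- If `z + e / z` is some `t` in `K`, that is, `z ^ 2 = t * z - e`, and some power of `z` is `ι`,
then `z` lies in `K(ι)` and its conjugate is the other root `e / z` of this equation. -/
theorem IsQuadraticConj.map_eq_of_add_inBase (hτ : IsQuadraticConj ι τ) {z : AlgebraicClosure K}
    (hz : z ≠ 0) {e : K} (ht : InBase (z + algebraMap K _ e * z⁻¹)) {j : ℕ} (hj : z ^ j = ι) :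
    z ∈ K⟮ι⟯ ∧ τ z = algebraMap K _ e * z⁻¹ := by
  obtain ⟨t, ht⟩ := ht
  have hz2 : z ^ 2 = algebraMap K _ t * z - algebraMap K _ e := by
    rw [ht]
    field_simp
    ring
  have hlin : ∀ j : ℕ, ∃ p q : K, z ^ j = algebraMap K _ p + algebraMap K _ q * z := by
    intro j
    induction j with
    | zero => exact ⟨1, 0, by simp⟩
    | succ j ih =>
      obtain ⟨p, q, h⟩ := ih
      refine ⟨-(q * e), p + q * t, ?_⟩
      rw [pow_succ, h]
      simp only [map_add, map_mul, map_neg]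
      linear_combination algebraMap K (AlgebraicClosure K) q * hz2
  obtain ⟨p, q, hpq⟩ := hlin j
  rw [hj] at hpq
  have hq : algebraMap K (AlgebraicClosure K) q ≠ 0 := by
    intro h
    rw [h, zero_mul, add_zero] at hpq
    exact hτ.notInBase ⟨p, hpq.symm⟩
  have hzF : z ∈ K⟮ι⟯ := by
    have : z = (ι - algebraMap K (AlgebraicClosure K) p) / algebraMap K (AlgebraicClosure K) q := by
      field_simp
      linear_combination -hpq
    rw [this]
    exact div_mem (sub_mem (mem_adjoin_simple_self K ι) (_root_.algebraMap_mem _ _))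
      (_root_.algebraMap_mem _ _)
  refine ⟨hzF, ?_⟩
  have hτz : (τ z) ^ 2 = algebraMap K _ t * τ z - algebraMap K _ e := by
    have := congrArg τ hz2
    simpa using this
  have hprod : (τ z - z) * (τ z - algebraMap K (AlgebraicClosure K) e * z⁻¹) = 0 := by
    rw [ht] at hτz
    field_simp at hτz ⊢
    linear_combination hτz
  rcases mul_eq_zero.1 hprod with h | h
  · exfalso
    obtain ⟨p, rfl⟩ := hτ.inBase z hzF (sub_eq_zero.1 h)
    exact hτ.notInBase ⟨p ^ j, by rw [map_pow, hj]⟩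
  · exact sub_eq_zero.1 h

/-! ### Roots of unity of `2`-power order in the quadratic extension -/

/-- The `2 ^ M`-th roots of unity lie in `K(ι)`, and conjugation inverts them. -/
def InvertsRootsOfUnity (ι : AlgebraicClosure K)
    (τ : AlgebraicClosure K ≃ₐ[K] AlgebraicClosure K) (M : ℕ) : Prop :=
  ∀ z : AlgebraicClosure K, z ^ 2 ^ M = 1 → z ∈ K⟮ι⟯ ∧ τ z = z⁻¹

/-- No root of unity of exact order `2 ^ M` is a square in `K(ι)`. -/
def PrimitiveRootsNonsquare (ι : AlgebraicClosure K) (M : ℕ) : Prop :=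
  ∀ z : AlgebraicClosure K, z ^ 2 ^ (M - 1) = -1 → ∀ y ∈ K⟮ι⟯, y ^ 2 ≠ z

theorem InvertsRootsOfUnity.mono {M N : ℕ} (h : InvertsRootsOfUnity ι τ N) (hMN : M ≤ N) :
    InvertsRootsOfUnity ι τ M := by
  intro z hz
  refine h z ?_
  rw [← Nat.add_sub_cancel' hMN, pow_add, pow_mul, hz, one_pow]

theorem IsPrimitiveRoot.invertsRootsOfUnity {ζ : AlgebraicClosure K} {M : ℕ}
    (hζ : IsPrimitiveRoot ζ (2 ^ M)) (h : ζ ∈ K⟮ι⟯) (h' : τ ζ = ζ⁻¹) :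
    InvertsRootsOfUnity ι τ M := by
  intro z hz
  obtain ⟨i, -, rfl⟩ := hζ.eq_pow_of_pow_eq_one hz
  exact ⟨pow_mem h i, by rw [map_pow, h', inv_pow]⟩

theorem IsPrimitiveRoot.pow_two_pow_pred {ζ : AlgebraicClosure K} {M : ℕ}
    (hζ : IsPrimitiveRoot ζ (2 ^ M)) (hM : 1 ≤ M) : ζ ^ 2 ^ (M - 1) = -1 := by
  have h := hζ.pow (a := 2 ^ (M - 1)) (b := 2) (by positivity)
    (by rw [← pow_succ, Nat.sub_add_cancel hM])
  exact h.eq_neg_one_of_two_right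

theorem isPrimitiveRoot_two_pow (h2 : (2 : K) ≠ 0) {z : AlgebraicClosure K} {M : ℕ} (hM : 1 ≤ M)
    (hz : z ^ 2 ^ (M - 1) = -1) : IsPrimitiveRoot z (2 ^ M) := by
  obtain ⟨M, rfl⟩ := Nat.exists_eq_add_of_le' hM
  have : Fact (Nat.Prime 2) := ⟨Nat.prime_two⟩
  rw [Nat.add_sub_cancel] at hz
  refine IsPrimitiveRoot.iff_orderOf.2 (orderOf_eq_prime_pow (fun h => ?_) ?_)
  · rw [hz] at h
    exact algebraicClosure_two_ne_zero h2 (by linear_combination -h)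
  · rw [pow_succ, pow_mul, hz]
    ring

variable {ε : ℕ → AlgebraicClosure K}

/-- A power of any primitive root of unity of order `2 ^ k`, `k ≥ 2`, is the given `ε 2`. -/
theorem exists_pow_eq_two (hε : ∀ k, IsPrimitiveRoot (ε k) (2 ^ k)) {k : ℕ} (hk : 2 ≤ k) :
    ∃ j : ℕ, ε k ^ j = ε 2 := by
  have : ε 2 ^ 2 ^ k = 1 := by
    rw [← Nat.add_sub_cancel' hk, pow_add, pow_mul, (hε 2).pow_eq_one, one_pow]
  obtain ⟨j, -, hj⟩ := (hε k).eq_pow_of_pow_eq_one this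
  exact ⟨j, hj⟩

theorem invertsRootsOfUnity_of_inBase (hε : ∀ k, IsPrimitiveRoot (ε k) (2 ^ k))
    (hτ : IsQuadraticConj (ε 2) τ) {k : ℕ} (hk : 2 ≤ k) (h : InBase (ε k + (ε k)⁻¹)) :
    InvertsRootsOfUnity (ε 2) τ k := by
  obtain ⟨j, hj⟩ := exists_pow_eq_two hε hk
  obtain ⟨h1, h2⟩ := hτ.map_eq_of_add_inBase ((hε k).ne_zero (by positivity)) (e := 1)
    (by simpa using h) hj
  exact (hε k).invertsRootsOfUnity h1 (by simpa using h2)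

theorem IsTypeC.invertsRootsOfUnity (hε : ∀ k, IsPrimitiveRoot (ε k) (2 ^ k))
    (hτ : IsQuadraticConj (ε 2) τ) (h : IsTypeC ε) (k : ℕ) : InvertsRootsOfUnity (ε 2) τ k :=
  (invertsRootsOfUnity_of_inBase hε hτ (le_max_right k 2) (h.2 _)).mono (le_max_left k 2)

theorem IsTypeD.invertsRootsOfUnity (hε : ∀ k, IsPrimitiveRoot (ε k) (2 ^ k))
    (hτ : IsQuadraticConj (ε 2) τ) {m : ℕ} (h : IsTypeD ε m) : InvertsRootsOfUnity (ε 2) τ m :=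
  invertsRootsOfUnity_of_inBase hε hτ h.2.1 h.2.2.1

theorem IsTypeE.map_eq (hε : ∀ k, IsPrimitiveRoot (ε k) (2 ^ k))
    (hτ : IsQuadraticConj (ε 2) τ) {m : ℕ} (h : IsTypeE ε m) :
    ε m ∈ K⟮ε 2⟯ ∧ τ (ε m) = -(ε m)⁻¹ := by
  obtain ⟨-, hm, hb⟩ := h
  obtain ⟨j, hj⟩ := exists_pow_eq_two hε (by omega : 2 ≤ m)
  obtain ⟨h1, h2⟩ := hτ.map_eq_of_add_inBase ((hε m).ne_zero (by positivity)) (e := -1)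
    (by simpa [sub_eq_add_neg] using hb) hj
  exact ⟨h1, by simpa using h2⟩

theorem IsTypeE.invertsRootsOfUnity (hε : ∀ k, IsPrimitiveRoot (ε k) (2 ^ k))
    (hτ : IsQuadraticConj (ε 2) τ) {m : ℕ} (h : IsTypeE ε m) :
    InvertsRootsOfUnity (ε 2) τ (m - 1) := by
  obtain ⟨h1, h2⟩ := h.map_eq hε hτ
  have hp : IsPrimitiveRoot (ε m ^ 2) (2 ^ (m - 1)) :=
    (hε m).pow (by positivity) (by rw [← pow_succ', Nat.sub_add_cancel (by have := h.2.1; omega)])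
  exact hp.invertsRootsOfUnity (pow_mem h1 2) (by rw [map_pow, h2, neg_sq, inv_pow])

/-- A square root `y` of a primitive root of order `2 ^ m` generates the roots of order
`2 ^ (m + 1)`, whose conjugate is `± 1 / y`. -/
theorem IsTypeD.primitiveRootsNonsquare (h2 : (2 : K) ≠ 0)
    (hε : ∀ k, IsPrimitiveRoot (ε k) (2 ^ k)) (hτ : IsQuadraticConj (ε 2) τ) {m : ℕ}
    (h : IsTypeD ε m) : PrimitiveRootsNonsquare (ε 2) m := by
  rintro z hz y hy rfl
  obtain ⟨-, hm, -, hn1, hn2⟩ := id h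
  rw [← pow_mul, ← pow_succ', Nat.sub_add_cancel (by omega)] at hz
  have hprim : IsPrimitiveRoot y (2 ^ (m + 1)) := isPrimitiveRoot_two_pow h2 (by omega) hz
  obtain ⟨i, -, hi⟩ := hprim.eq_pow_of_pow_eq_one (hε (m + 1)).pow_eq_one
  have hw : ε (m + 1) ∈ K⟮ε 2⟯ := hi ▸ pow_mem hy i
  have hw0 : ε (m + 1) ≠ 0 := (hε (m + 1)).ne_zero (by positivity)
  have hsq : τ (ε (m + 1)) ^ 2 = ((ε (m + 1))⁻¹) ^ 2 := by
    rw [← map_pow, inv_pow]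
    exact (h.invertsRootsOfUnity hε hτ _
      (by rw [← pow_mul, ← pow_succ', (hε (m + 1)).pow_eq_one])).2
  rcases sq_eq_sq_iff_eq_or_eq_neg.1 hsq with h3 | h3
  · exact hn1 (hτ.inBase _ (add_mem hw (inv_mem hw))
      (by rw [map_add, map_inv₀, h3, inv_inv, add_comm]))
  · refine hn2 (hτ.inBase _ (sub_mem hw (inv_mem hw)) ?_)
    rw [map_sub, map_inv₀, h3, inv_neg, inv_inv]
    ring

/-- For a square root `y` of a primitive root of order `2 ^ m`, the norm `y * τ y` would be a square
root of `-1` in `K`. -/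
theorem IsTypeE.primitiveRootsNonsquare (h2 : (2 : K) ≠ 0)
    (hε : ∀ k, IsPrimitiveRoot (ε k) (2 ^ k)) (hτ : IsQuadraticConj (ε 2) τ) {m : ℕ}
    (h : IsTypeE ε m) : PrimitiveRootsNonsquare (ε 2) m := by
  rintro z hz y hy hyz
  have hm := h.2.1
  have hpow : z ^ 2 ^ m = 1 := by
    rw [← Nat.sub_add_cancel (by omega : 1 ≤ m), pow_succ, pow_mul, hz]
    ring
  obtain ⟨i, -, hi⟩ := (hε m).eq_pow_of_pow_eq_one hpow
  have hodd : Odd i := by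
    rw [← Nat.not_even_iff_odd]
    rintro ⟨j, rfl⟩
    rw [← hi, ← two_mul, ← pow_mul, mul_right_comm, ← pow_succ', Nat.sub_add_cancel (by omega),
      pow_mul, (hε m).pow_eq_one, one_pow] at hz
    exact algebraicClosure_two_ne_zero h2 (by linear_combination hz)
  have hz0 : z ≠ 0 := by
    rintro rfl
    simp at hpow
  have hτz : τ z = -z⁻¹ := by
    rw [← hi, map_pow, (h.map_eq hε hτ).2, hodd.neg_pow, inv_pow]
  refine hτ.ne_of_sq (y := y * τ y) ?_
    (hτ.inBase _ (mul_mem hy (hτ.map_mem y hy)) (by rw [map_mul, hτ.map_map y hy, mul_comm]))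
  rw [mul_pow, ← map_pow, hyz, hτz, mul_neg, mul_inv_cancel₀ hz0]

end Quadratic

/-! ### The orbit belonging to a dyadic mean -/

section Means

variable {K A : Type*} [Field K] [Ring A] [Algebra K A]

theorem sum_pow_two_pow {F : Type*} [Field F] {z : F} {N : ℕ} (hz : z ^ 2 ^ N = 1)
    [Decidable (z = 1)] :
    ∑ j ∈ Finset.range (2 ^ N), z ^ j = if z = 1 then 2 ^ N else 0 := by
  split_ifs with h
  · simp [h]
  · have := geom_sum_mul z (2 ^ N)
    rw [hz, sub_self] at this
    exact (mul_eq_zero.1 this).resolve_right (sub_ne_zero.2 h)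

theorem map_dyadicMean (ψ : A →ₐ[K] AlgebraicClosure K) (N : ℕ) (c : ℕ → K) (u : A) :
    ψ (dyadicMean N c u) =
      (2 ^ N)⁻¹ * ∑ j ∈ Finset.range (2 ^ N), algebraMap K _ (c j) * ψ u ^ j := by
  rw [dyadicMean, Algebra.smul_def, map_mul, AlgHom.commutes, map_inv₀, map_pow, map_ofNat, map_sum]
  simp only [Algebra.smul_def, map_mul, AlgHom.commutes, map_pow]

open Classical in
theorem map_dyadicMean_single (h2 : (2 : K) ≠ 0) (ψ : A →ₐ[K] AlgebraicClosure K) {N : ℕ}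
    {c : ℕ → K} {u : A} {α : AlgebraicClosure K} (hα : α ≠ 0) (hu : ψ u ^ 2 ^ N = α ^ 2 ^ N)
    (hc : ∀ j, algebraMap K _ (c j) = α⁻¹ ^ j) :
    ψ (dyadicMean N c u) = if ψ u = α then 1 else 0 := by
  have h2' := algebraicClosure_two_ne_zero h2
  have h : (α⁻¹ * ψ u) ^ 2 ^ N = 1 := by
    rw [mul_pow, hu, inv_pow, inv_mul_cancel₀ (pow_ne_zero _ hα)]
  simp only [map_dyadicMean, hc, ← mul_pow]
  rw [sum_pow_two_pow h, inv_mul_eq_one₀ hα, eq_comm (a := α)]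
  split_ifs
  · exact inv_mul_cancel₀ (pow_ne_zero _ h2')
  · simp

open Classical in
theorem map_dyadicMean_pair (h2 : (2 : K) ≠ 0) (ψ : A →ₐ[K] AlgebraicClosure K) {N : ℕ}
    {c : ℕ → K} {u : A} {α β : AlgebraicClosure K} (hα : α ≠ 0) (hβ : β ≠ 0) (hαβ : β ≠ α)
    (hu : ψ u ^ 2 ^ N = α ^ 2 ^ N) (hu' : ψ u ^ 2 ^ N = β ^ 2 ^ N)
    (hc : ∀ j, algebraMap K _ (c j) = α⁻¹ ^ j + β⁻¹ ^ j) :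
    ψ (dyadicMean N c u) = if ψ u = α ∨ ψ u = β then 1 else 0 := by
  have h2' := algebraicClosure_two_ne_zero h2
  have h : ∀ γ : AlgebraicClosure K, γ ≠ 0 → ψ u ^ 2 ^ N = γ ^ 2 ^ N →
      (γ⁻¹ * ψ u) ^ 2 ^ N = 1 := fun γ hγ h => by
    rw [mul_pow, h, inv_pow, inv_mul_cancel₀ (pow_ne_zero _ hγ)]
  simp only [map_dyadicMean, hc, add_mul, Finset.sum_add_distrib, ← mul_pow]
  rw [sum_pow_two_pow (h α hα hu), sum_pow_two_pow (h β hβ hu'), inv_mul_eq_one₀ hα,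
    inv_mul_eq_one₀ hβ, eq_comm (a := α), eq_comm (a := β)]
  by_cases h1 : ψ u = α
  · rw [if_pos h1, if_neg (fun h => hαβ (h.symm.trans h1)), if_pos (Or.inl h1), add_zero,
      inv_mul_cancel₀ (pow_ne_zero _ h2')]
  · by_cases h3 : ψ u = β
    · rw [if_neg h1, if_pos h3, if_pos (Or.inr h3), zero_add,
        inv_mul_cancel₀ (pow_ne_zero _ h2')]
    · rw [if_neg h1, if_neg h3, if_neg (by tauto)]
      simp

theorem map_scaledPow (ψ : A →ₐ[K] AlgebraicClosure K) (b : Kˣ) (x : A) (k r : ℕ) :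
    ψ (scaledPow b x k r) = ((algebraMap K _ (b : K))⁻¹) ^ 2 ^ r * ψ x ^ 2 ^ (k + r) := by
  simp [scaledPow, Algebra.smul_def]

theorem map_scaledPow_eq_pow (ψ : A →ₐ[K] AlgebraicClosure K) (b : Kˣ) (x : A) (k r : ℕ) :
    ψ (scaledPow b x k r) = ψ (scaledPow b x k 0) ^ 2 ^ r := by
  simp only [map_scaledPow, pow_zero, pow_one, add_zero, mul_pow, ← pow_mul, ← pow_add]

theorem pow_eq_mul_map_scaledPow (ψ : A →ₐ[K] AlgebraicClosure K) (b : Kˣ) (x : A) (k r : ℕ) :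
    ψ x ^ 2 ^ (k + r) = algebraMap K _ (b : K) ^ 2 ^ r * ψ (scaledPow b x k r) := by
  have hb : algebraMap K (AlgebraicClosure K) (b : K) ≠ 0 := by simp
  rw [map_scaledPow, ← mul_assoc, ← mul_pow, mul_inv_cancel₀ hb, one_pow, one_mul]

/-- Any two roots of `X ^ (2 ^ k) - c`, with `c ∈ K(ι)` not a square there, are conjugate, because
this polynomial is irreducible over `K(ι)`. -/
theorem exists_algEquiv_of_pow_eq (h2 : (2 : K) ≠ 0) {ι : AlgebraicClosure K} (hι : ι ^ 2 = -1)
    {c : AlgebraicClosure K} (hc : c ∈ K⟮ι⟯) {k : ℕ} (hns : k = 0 ∨ ∀ y ∈ K⟮ι⟯, y ^ 2 ≠ c)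
    {ξ ξ' : AlgebraicClosure K} (hξ : ξ ^ 2 ^ k = c) (hξ' : ξ' ^ 2 ^ k = c) :
    ∃ σ : AlgebraicClosure K ≃ₐ[K] AlgebraicClosure K, σ ξ = ξ' := by
  rcases hns with rfl | hns
  · refine ⟨AlgEquiv.refl, ?_⟩
    rw [pow_zero, pow_one] at hξ hξ'
    rw [hξ, hξ', AlgEquiv.coe_refl, id]
  have h2' : (2 : K⟮ι⟯) ≠ 0 := by
    rw [← map_ofNat (algebraMap K K⟮ι⟯) 2]
    simpa using h2
  have hirr := irreducible_X_pow_two_pow_sub_C h2' (i := AdjoinSimple.gen K ι)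
    (Subtype.ext (by simpa using hι)) (c := ⟨c, hc⟩)
    (fun y hy => hns y y.2 (by simpa using congrArg Subtype.val hy)) k
  have hmin : ∀ η : AlgebraicClosure K, η ^ 2 ^ k = c →
      minpoly K⟮ι⟯ η = Polynomial.X ^ 2 ^ k - Polynomial.C ⟨c, hc⟩ := fun η hη =>
    (minpoly.eq_of_irreducible_of_monic hirr (by simp [hη, IntermediateField.algebraMap_apply])
      (Polynomial.monic_X_pow_sub_C _ (by positivity))).symm
  have hconj : IsConjRoot K⟮ι⟯ ξ' ξ := by rw [isConjRoot_def, hmin ξ hξ, hmin ξ' hξ']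
  obtain ⟨σ, hσ⟩ := isConjRoot_iff_exists_algEquiv.1 hconj
  exact ⟨σ.restrictScalars K, hσ⟩

variable {ε : ℕ → AlgebraicClosure K} {τ : AlgebraicClosure K ≃ₐ[K] AlgebraicClosure K}
  {x : A} {n s r : ℕ} {a b : Kˣ}

theorem HeightEq.le (hs : HeightEq ε n a s) : s ≤ n := hs.1.1

theorem HeightEq.notMem (hs : HeightEq ε n a s) (hsn : s ≠ n) {y : AlgebraicClosure K}
    (hy : y ∈ K⟮ε 2⟯) : y ^ 2 ^ (s + 1) ≠ algebraMap K _ (a : K) := by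
  intro h
  have hmem : s + 1 ∈ {t : ℕ | t ≤ n ∧ a ∈ powersInQuadratic ε t} := by
    refine ⟨by have := hs.le; omega, ⟨y, hy⟩, ?_⟩
    apply (algebraMap K⟮ε 2⟯ (AlgebraicClosure K)).injective
    rw [map_pow, ← IsScalarTower.algebraMap_apply]
    exact h
  exact absurd (hs.2 hmem) (by omega)

/-- If `α` is a possible value of `b ^ (-2 ^ r) * x ^ (2 ^ (n - s + r))`, then `b ^ (2 ^ r) * α` is
not a square in `K(ε 2)`, unless it is the value of `x` itself: for `r = 0` by the maximality of
`s`, and for `r > 0` because `α` is not a square. -/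
theorem HeightEq.eq_zero_or_nonsquare (hs : HeightEq ε n a s) {α : AlgebraicClosure K}
    (hα : algebraMap K _ (b : K) ^ 2 ^ s * α ^ 2 ^ (s - r) = algebraMap K _ (a : K))
    (hns : r = 0 ∨ ∀ y ∈ K⟮ε 2⟯, y ^ 2 ≠ α) :
    n - s + r = 0 ∨ ∀ y ∈ K⟮ε 2⟯, y ^ 2 ≠ algebraMap K _ (b : K) ^ 2 ^ r * α := by
  rcases Nat.eq_zero_or_pos r with rfl | hr
  · by_cases hsn : s = n
    · left
      omega
    · refine Or.inr fun y hy h => hs.notMem hsn hy ?_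
      rw [pow_succ', pow_mul, h, ← hα, mul_pow, pow_zero, pow_one, Nat.sub_zero]
  · right
    intro y hy h
    have hb : algebraMap K (AlgebraicClosure K) (b : K) ≠ 0 := by simp
    refine hns.resolve_left hr.ne' (y / algebraMap K _ (b : K) ^ 2 ^ (r - 1))
      (div_mem hy (pow_mem (_root_.algebraMap_mem _ _) _)) ?_
    rw [div_pow, h, ← pow_mul, ← pow_succ, Nat.sub_add_cancel hr,
      mul_div_cancel_left₀ _ (pow_ne_zero _ hb)]

/-- The homomorphisms taking conjugate values at `b ^ (-2 ^ r) * x ^ (2 ^ (n - s + r))` are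
conjugate. -/
theorem IsPureGenerator.exists_conj (h2 : (2 : K) ≠ 0) (hx : IsPureGenerator x (2 ^ n) (a : K))
    (hε2 : ε 2 ^ 2 = -1) (hs : HeightEq ε n a s) {α : AlgebraicClosure K} (hα : α ∈ K⟮ε 2⟯)
    (hval : algebraMap K _ (b : K) ^ 2 ^ s * α ^ 2 ^ (s - r) = algebraMap K _ (a : K))
    (hns : r = 0 ∨ ∀ y ∈ K⟮ε 2⟯, y ^ 2 ≠ α) {ψ ψ' : A →ₐ[K] AlgebraicClosure K}
    (ρ : AlgebraicClosure K ≃ₐ[K] AlgebraicClosure K)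
    (h : ρ (ψ (scaledPow b x (n - s) r)) = α) (h' : ψ' (scaledPow b x (n - s) r) = α) :
    ∃ σ : AlgebraicClosure K ≃ₐ[K] AlgebraicClosure K, ∀ y, σ (ψ y) = ψ' y := by
  obtain ⟨σ, hσ⟩ := exists_algEquiv_of_pow_eq h2 hε2
    (mul_mem (pow_mem (_root_.algebraMap_mem _ (b : K)) (2 ^ r)) hα)
    (hs.eq_zero_or_nonsquare hval hns) (ξ := ρ (ψ x)) (ξ' := ψ' x)
    (by rw [← map_pow, pow_eq_mul_map_scaledPow ψ b x, map_mul, h, map_pow, AlgEquiv.commutes])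
    (by rw [pow_eq_mul_map_scaledPow ψ' b x, h'])
  have := hx.hom_ext (((ρ.trans σ : AlgebraicClosure K ≃ₐ[K] AlgebraicClosure K) :
    AlgebraicClosure K →ₐ[K] AlgebraicClosure K).comp ψ) ψ' hσ
  exact ⟨ρ.trans σ, fun y => DFunLike.congr_fun this y⟩

theorem IsPureGenerator.exists_scaledPow_eq (hx : IsPureGenerator x (2 ^ n) (a : K))
    (hsn : s ≤ n) (hr : r ≤ s) {α : AlgebraicClosure K}
    (hval : algebraMap K _ (b : K) ^ 2 ^ s * α ^ 2 ^ (s - r) = algebraMap K _ (a : K)) :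
    ∃ ψ : A →ₐ[K] AlgebraicClosure K, ψ (scaledPow b x (n - s) r) = α := by
  obtain ⟨ξ, hξ⟩ := IsAlgClosed.exists_pow_nat_eq (algebraMap K _ (b : K) ^ 2 ^ r * α)
    (n := 2 ^ (n - s + r)) (by positivity)
  obtain ⟨ψ, rfl⟩ := hx.exists_hom ξ (by
    rw [show n = n - s + r + (s - r) by omega, pow_add, pow_mul, hξ, mul_pow, ← pow_mul,
      ← pow_add, Nat.add_sub_cancel' hr, hval])
  have hb : algebraMap K (AlgebraicClosure K) (b : K) ≠ 0 := by simp
  exact ⟨ψ, mul_left_cancel₀ (pow_ne_zero _ hb)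
    ((pow_eq_mul_map_scaledPow ψ b x _ r).symm.trans hξ)⟩

theorem IsPureGenerator.mul_scaledPow_pow (hx : IsPureGenerator x (2 ^ n) (a : K))
    (hsn : s ≤ n) (hr : r ≤ s) (ψ : A →ₐ[K] AlgebraicClosure K) :
    algebraMap K _ (b : K) ^ 2 ^ s * ψ (scaledPow b x (n - s) r) ^ 2 ^ (s - r) =
      algebraMap K _ (a : K) := by
  rw [← AlgHom.commutes ψ (a : K), ← hx.pow_eq, map_pow]
  conv_rhs => rw [show n = n - s + r + (s - r) by omega, pow_add, pow_mul,
    pow_eq_mul_map_scaledPow ψ b x (n - s) r, mul_pow, ← pow_mul, ← pow_add,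
    Nat.add_sub_cancel' hr]

theorem IsPureGenerator.isOrbitIndicator_single (h2 : (2 : K) ≠ 0)
    (hx : IsPureGenerator x (2 ^ n) (a : K)) (hε2 : ε 2 ^ 2 = -1) (hs : HeightEq ε n a s)
    (hr : r ≤ s) {α : AlgebraicClosure K} (hα : α ∈ K⟮ε 2⟯)
    (hval : algebraMap K _ (b : K) ^ 2 ^ s * α ^ 2 ^ (s - r) = algebraMap K _ (a : K))
    (hns : r = 0 ∨ ∀ y ∈ K⟮ε 2⟯, y ^ 2 ≠ α) {c : ℕ → K}
    (hc : ∀ j, algebraMap K _ (c j) = α⁻¹ ^ j) :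
    IsOrbitIndicator (dyadicMean (s - r) c (scaledPow b x (n - s) r))
      {ψ | ψ (scaledPow b x (n - s) r) = α} := by
  have hb : algebraMap K (AlgebraicClosure K) (b : K) ≠ 0 := by simp
  have hα0 : α ≠ 0 := by
    rintro rfl
    rw [zero_pow (by positivity), mul_zero] at hval
    exact absurd hval.symm (by simp)
  have key : ∀ ψ : A →ₐ[K] AlgebraicClosure K, _ := fun ψ =>
    map_dyadicMean_single h2 ψ (N := s - r) (c := c) (u := scaledPow b x (n - s) r) hα0
      (mul_left_cancel₀ (pow_ne_zero _ hb)
        ((hx.mul_scaledPow_pow hs.le hr ψ).trans hval.symm)) hc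
  refine ⟨hx.exists_scaledPow_eq hs.le hr hval, fun ψ hψ => ?_, fun ψ hψ => ?_,
    fun ψ hψ ψ' hψ' => ?_⟩
  · rw [key ψ]
    exact if_pos hψ
  · rw [key ψ]
    exact if_neg hψ
  · exact hx.exists_conj h2 hε2 hs hα hval hns AlgEquiv.refl hψ hψ'

theorem IsPureGenerator.isOrbitIndicator_pair (h2 : (2 : K) ≠ 0)
    (hx : IsPureGenerator x (2 ^ n) (a : K)) (hτ : IsQuadraticConj (ε 2) τ)
    (hs : HeightEq ε n a s) (hr : r ≤ s) {α : AlgebraicClosure K} (hα : α ∈ K⟮ε 2⟯)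
    (hατ : τ α ≠ α)
    (hval : algebraMap K _ (b : K) ^ 2 ^ s * α ^ 2 ^ (s - r) = algebraMap K _ (a : K))
    (hns : r = 0 ∨ ∀ y ∈ K⟮ε 2⟯, y ^ 2 ≠ α) {c : ℕ → K}
    (hc : ∀ j, algebraMap K _ (c j) = α⁻¹ ^ j + (τ α)⁻¹ ^ j) :
    IsOrbitIndicator (dyadicMean (s - r) c (scaledPow b x (n - s) r))
      {ψ | ψ (scaledPow b x (n - s) r) = α ∨ ψ (scaledPow b x (n - s) r) = τ α} := by
  have hb : algebraMap K (AlgebraicClosure K) (b : K) ≠ 0 := by simp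
  have hα0 : α ≠ 0 := by
    rintro rfl
    simp at hατ
  have hval' : algebraMap K _ (b : K) ^ 2 ^ s * (τ α) ^ 2 ^ (s - r) = algebraMap K _ (a : K) := by
    simpa using congrArg τ hval
  have hns' : r = 0 ∨ ∀ y ∈ K⟮ε 2⟯, y ^ 2 ≠ τ α := hns.imp_right fun h y hy hyα =>
    h (τ y) (hτ.map_mem y hy) (by rw [← map_pow, hyα, hτ.map_map α hα])
  have key : ∀ ψ : A →ₐ[K] AlgebraicClosure K, _ := fun ψ =>
    map_dyadicMean_pair h2 ψ (N := s - r) (c := c) (u := scaledPow b x (n - s) r) hα0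
      (by simpa using hα0) hατ
      (mul_left_cancel₀ (pow_ne_zero _ hb)
        ((hx.mul_scaledPow_pow hs.le hr ψ).trans hval.symm))
      (mul_left_cancel₀ (pow_ne_zero _ hb)
        ((hx.mul_scaledPow_pow hs.le hr ψ).trans hval'.symm)) hc
  refine ⟨?_, fun ψ hψ => ?_, fun ψ hψ => ?_, fun ψ hψ ψ' hψ' => ?_⟩
  · obtain ⟨ψ, hψ⟩ := hx.exists_scaledPow_eq hs.le hr hval
    exact ⟨ψ, Or.inl hψ⟩
  · rw [key ψ]
    exact if_pos hψ
  · rw [key ψ]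
    exact if_neg hψ
  · have hmem := hτ.map_mem α hα
    rcases hψ with hψ | hψ <;> rcases hψ' with hψ' | hψ'
    · exact hx.exists_conj h2 hτ.sq hs hα hval hns AlgEquiv.refl hψ hψ'
    · exact hx.exists_conj h2 hτ.sq hs hmem hval' hns' τ (by rw [hψ]) hψ'
    · exact hx.exists_conj h2 hτ.sq hs hα hval hns τ (by rw [hψ, hτ.map_map α hα]) hψ'
    · exact hx.exists_conj h2 hτ.sq hs hmem hval' hns' AlgEquiv.refl hψ hψ'

/-- A family of values `α i` in `K(ε 2)`, pairwise not conjugate, gives a list of orbits. -/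
theorem IsPureGenerator.listsOrbits_map (h2 : (2 : K) ≠ 0)
    (hx : IsPureGenerator x (2 ^ n) (a : K)) (hτ : IsQuadraticConj (ε 2) τ)
    (hs : HeightEq ε n a s) (hr : r ≤ s) {I : Finset ℕ} {α : ℕ → AlgebraicClosure K}
    (hα : ∀ i ∈ I, α i ∈ K⟮ε 2⟯)
    (hval : ∀ i ∈ I,
      algebraMap K _ (b : K) ^ 2 ^ s * α i ^ 2 ^ (s - r) = algebraMap K _ (a : K))
    (hns : r = 0 ∨ ∀ i ∈ I, ∀ y ∈ K⟮ε 2⟯, y ^ 2 ≠ α i)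
    (hατ : ∀ i ∈ I, ∀ j ∈ I, τ (α i) ≠ α j)
    (hinj : ∀ i ∈ I, ∀ j ∈ I, α i = α j → i = j) {c : ℕ → ℕ → K}
    (hc : ∀ i j, algebraMap K _ (c i j) = (α i)⁻¹ ^ j + (τ (α i))⁻¹ ^ j) :
    ListsOrbits (I.val.map fun i => dyadicMean (s - r) (c i) (scaledPow b x (n - s) r))
      {ψ : A →ₐ[K] AlgebraicClosure K | ∃ i ∈ I, ψ (scaledPow b x (n - s) r) = α i ∨
        ψ (scaledPow b x (n - s) r) = τ (α i)} := by
  refine ListsOrbits.map (P := fun i => {ψ : A →ₐ[K] AlgebraicClosure K |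
    ψ (scaledPow b x (n - s) r) = α i ∨ ψ (scaledPow b x (n - s) r) = τ (α i)})
    (fun i hi => hx.isOrbitIndicator_pair h2 hτ hs hr (hα i hi) (hατ i hi i hi) (hval i hi)
      (hns.imp_right fun h => h i hi) (hc i)) fun i hi j hj hij => ?_
  rw [Set.disjoint_left]
  rintro ψ (h | h) (h' | h')
  · exact hij (hinj i hi j hj (h.symm.trans h'))
  · exact hατ j hj i hi (h'.symm.trans h)
  · exact hατ i hi j hj (h.symm.trans h')
  · exact hij (hinj i hi j hj (τ.injective (h.symm.trans h')))

theorem IsQuadraticConj.exists_coeff (hτ : IsQuadraticConj (ε 2) τ)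
    {α : ℕ → AlgebraicClosure K} (hα : ∀ i, α i ∈ K⟮ε 2⟯) :
    ∃ c : ℕ → ℕ → K, ∀ i j, algebraMap K _ (c i j) = (α i)⁻¹ ^ j + (τ (α i))⁻¹ ^ j := by
  have h : ∀ i j, InBase ((α i)⁻¹ ^ j + (τ (α i))⁻¹ ^ j) := fun i j =>
    hτ.inBase _ (add_mem (pow_mem (inv_mem (hα i)) j)
      (pow_mem (inv_mem (hτ.map_mem _ (hα i))) j))
      (by rw [map_add, map_pow, map_pow, map_inv₀, map_inv₀, hτ.map_map _ (hα i), add_comm])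
  choose c hc using h
  exact ⟨c, hc⟩

end Means

/-! ### Families of orbits indexed by roots of unity -/

section Families

variable {K A : Type*} [Field K] [Ring A] [Algebra K A]
  {ε : ℕ → AlgebraicClosure K} {τ : AlgebraicClosure K ≃ₐ[K] AlgebraicClosure K}
  {x : A} {n s r : ℕ} {a b : Kˣ}

theorem neg_one_ne_one (h2 : (2 : K) ≠ 0) : (-1 : AlgebraicClosure K) ≠ 1 := fun h =>
  algebraicClosure_two_ne_zero h2 (by linear_combination -h)

/-- The values `β * δ ^ i`, where `δ` is a root of unity of order `2 ^ N`, represent the conjugacy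
classes in `β * μ`, where `μ` is the group of roots of unity of order `2 ^ (N + 1)`, provided that
conjugation interchanges the two cosets of `δ` in `β * μ`. -/
theorem IsPureGenerator.listsOrbits_coset (h2 : (2 : K) ≠ 0)
    (hx : IsPureGenerator x (2 ^ n) (a : K)) (hτ : IsQuadraticConj (ε 2) τ)
    (hs : HeightEq ε n a s) (hr : r ≤ s) {N : ℕ} (hN : N ≤ s - r) {β δ : AlgebraicClosure K}
    (hδ : IsPrimitiveRoot δ (2 ^ N)) (hβF : β ∈ K⟮ε 2⟯) (hδF : δ ∈ K⟮ε 2⟯)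
    (hβ : τ β ^ 2 ^ N = -β ^ 2 ^ N)
    (hval : algebraMap K _ (b : K) ^ 2 ^ s * β ^ 2 ^ (s - r) = algebraMap K _ (a : K))
    (hns : r = 0 ∨ ∀ z, z ^ 2 ^ N = 1 → ∀ y ∈ K⟮ε 2⟯, y ^ 2 ≠ β * z) {c : ℕ → ℕ → K}
    (hc : ∀ i j, algebraMap K _ (c i j) = (β * δ ^ i)⁻¹ ^ j + (τ (β * δ ^ i))⁻¹ ^ j) :
    ListsOrbits
      ((Finset.range (2 ^ N)).val.map
        fun i => dyadicMean (s - r) (c i) (scaledPow b x (n - s) r))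
      {ψ : A →ₐ[K] AlgebraicClosure K |
        (β⁻¹ * ψ (scaledPow b x (n - s) r)) ^ 2 ^ (N + 1) = 1} := by
  have hβ0 : β ≠ 0 := by
    rintro rfl
    rw [zero_pow (by positivity), mul_zero] at hval
    exact absurd hval.symm (by simp)
  have hδ1 : ∀ i, (δ ^ i) ^ 2 ^ N = 1 := fun i => by rw [pow_right_comm, hδ.pow_eq_one, one_pow]
  have hα : ∀ i, (β * δ ^ i) ^ 2 ^ N = β ^ 2 ^ N := fun i => by rw [mul_pow, hδ1, mul_one]
  have hτα : ∀ i, τ (β * δ ^ i) ^ 2 ^ N = -β ^ 2 ^ N := fun i => by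
    rw [← map_pow, hα, map_pow, hβ]
  have hmain := hx.listsOrbits_map h2 hτ hs hr (I := Finset.range (2 ^ N))
    (α := fun i => β * δ ^ i) (b := b) (fun i _ => mul_mem hβF (pow_mem hδF i))
    (fun i _ => by
      rw [mul_pow, ← Nat.add_sub_cancel' hN, pow_add, pow_mul (δ ^ i), hδ1, one_pow, mul_one,
        ← pow_add, Nat.add_sub_cancel' hN, hval])
    (hns.imp_right fun h i _ => h _ (hδ1 i))
    (fun i _ j _ h => by
      have h' := hτα i
      rw [h, hα] at h'
      exact neg_one_ne_one h2 (mul_right_cancel₀ (pow_ne_zero (2 ^ N) hβ0)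
        (by rw [neg_one_mul, one_mul, ← h'])))
    (fun i hi j hj h => hδ.pow_inj (Finset.mem_range.1 hi) (Finset.mem_range.1 hj)
      (mul_left_cancel₀ hβ0 h)) hc
  refine hmain.congr rfl fun ψ => ?_
  simp only [Set.mem_ofPred_eq]
  generalize ψ (scaledPow b x (n - s) r) = v
  have hiff : (β⁻¹ * v) ^ 2 ^ (N + 1) = 1 ↔ v ^ 2 ^ N = β ^ 2 ^ N ∨ v ^ 2 ^ N = -β ^ 2 ^ N := by
    rw [mul_pow, inv_pow, inv_mul_eq_one₀ (pow_ne_zero _ hβ0), pow_succ, pow_mul, pow_mul,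
      ← sq_eq_sq_iff_eq_or_eq_neg, eq_comm]
  have : NeZero (2 ^ N) := ⟨by positivity⟩
  rw [hiff]
  constructor
  · rintro ⟨i, -, h | h⟩
    · left
      rw [h, hα]
    · right
      rw [h, hτα]
  · rintro (h | h)
    · obtain ⟨i, hi, hi'⟩ := hδ.eq_pow_of_pow_eq_one (ξ := v / β)
        (by rw [div_pow, h, div_self (pow_ne_zero _ hβ0)])
      exact ⟨i, Finset.mem_range.2 hi, Or.inl (by rw [hi', mul_div_cancel₀ _ hβ0])⟩
    · have hτβ0 : τ β ≠ 0 := by simpa using hβ0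
      obtain ⟨i, hi, hi'⟩ := (hδ.map_of_injective τ.injective).eq_pow_of_pow_eq_one (ξ := v / τ β)
        (by rw [div_pow, h, ← hβ, div_self (pow_ne_zero _ hτβ0)])
      exact ⟨i, Finset.mem_range.2 hi,
        Or.inr (by rw [map_mul, map_pow, hi', mul_div_cancel₀ _ hτβ0])⟩

/-- The values `κ`, `-κ` and `κ * δ ^ i` for `1 ≤ i < 2 ^ (M - 1)`, where `δ` is a root of unity of
order `2 ^ M` and `κ ∈ K`, represent the conjugacy classes in `κ * μ`, where `μ` is the group of
roots of unity of order `2 ^ M`, provided that conjugation inverts `μ`. -/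
theorem IsPureGenerator.listsOrbits_roots (h2 : (2 : K) ≠ 0)
    (hx : IsPureGenerator x (2 ^ n) (a : K)) (hτ : IsQuadraticConj (ε 2) τ)
    (hs : HeightEq ε n a s) (hr : r ≤ s) {M : ℕ} (hM1 : 1 ≤ M) (hM : M ≤ s - r)
    {δ : AlgebraicClosure K} (hδ : IsPrimitiveRoot δ (2 ^ M))
    (hinv : InvertsRootsOfUnity (ε 2) τ M) {κ : K}
    (hval : algebraMap K _ (b : K) ^ 2 ^ s * algebraMap K _ κ ^ 2 ^ (s - r) =
      algebraMap K (AlgebraicClosure K) (a : K))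
    (hns : r = 0 ∨ ∀ z, z ^ 2 ^ M = 1 → ∀ y ∈ K⟮ε 2⟯, y ^ 2 ≠ algebraMap K _ κ * z)
    {c : ℕ → ℕ → K}
    (hc : ∀ i j, algebraMap K _ (c i j) =
      (algebraMap K _ κ)⁻¹ ^ j * (δ ^ (i * j) + δ⁻¹ ^ (i * j))) :
    ListsOrbits
      ({dyadicMean (s - r) (fun j => κ⁻¹ ^ j) (scaledPow b x (n - s) r),
        dyadicMean (s - r) (fun j => (-1) ^ j * κ⁻¹ ^ j) (scaledPow b x (n - s) r)} +
      (Finset.Ico 1 (2 ^ (M - 1))).val.map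
        fun i => dyadicMean (s - r) (c i) (scaledPow b x (n - s) r))
      {ψ : A →ₐ[K] AlgebraicClosure K |
        ((algebraMap K _ κ)⁻¹ * ψ (scaledPow b x (n - s) r)) ^ 2 ^ M = 1} := by
  set k := algebraMap K (AlgebraicClosure K) κ with hk
  have hk0 : k ≠ 0 := by
    intro h
    rw [h, zero_pow (by positivity), mul_zero] at hval
    exact absurd hval.symm (by simp)
  have hkF : k ∈ K⟮ε 2⟯ := _root_.algebraMap_mem _ κ
  have hδ0 : δ ≠ 0 := hδ.ne_zero (by positivity)
  obtain ⟨hδF, hτδ⟩ := hinv δ hδ.pow_eq_one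
  have h2M : 2 ^ M = 2 ^ (M - 1) + 2 ^ (M - 1) := by
    rw [← mul_two, ← pow_succ, Nat.sub_add_cancel hM1]
  have hhalf : δ ^ 2 ^ (M - 1) = -1 := hδ.pow_two_pow_pred hM1
  have hpos : 0 < 2 ^ (M - 1) := by positivity
  have hδ1 : ∀ i, (δ ^ i) ^ 2 ^ M = 1 := fun i => by rw [pow_right_comm, hδ.pow_eq_one, one_pow]
  have hτα : ∀ i, τ (k * δ ^ i) = k * δ⁻¹ ^ i := fun i => by
    rw [map_mul, map_pow, hτδ, hk, AlgEquiv.commutes]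
  have hvalz : ∀ z : AlgebraicClosure K, z ^ 2 ^ M = 1 →
      algebraMap K _ (b : K) ^ 2 ^ s * (k * z) ^ 2 ^ (s - r) =
        algebraMap K (AlgebraicClosure K) (a : K) := fun z hz => by
    rw [mul_pow, ← Nat.add_sub_cancel' hM, pow_add, pow_mul z, hz, one_pow, mul_one,
      ← pow_add, Nat.add_sub_cancel' hM, hval]
  have hneg : (-1 : AlgebraicClosure K) ^ 2 ^ M = 1 := by rw [← hhalf, hδ1]
  have hsingle : ∀ (z : AlgebraicClosure K) (c : ℕ → K), z ∈ K⟮ε 2⟯ → z ^ 2 ^ M = 1 →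
      (∀ j, algebraMap K _ (c j) = (k * z)⁻¹ ^ j) → _ := fun z c hzF hz hc =>
    hx.isOrbitIndicator_single h2 hτ.sq hs hr (mul_mem hkF hzF) (hvalz z hz)
      (hns.imp_right fun h => h z hz) hc
  have h1 := hsingle 1 (fun j => κ⁻¹ ^ j) (one_mem _) (one_pow _) fun j => by simp [hk]
  have h3 := hsingle (-1) (fun j => (-1) ^ j * κ⁻¹ ^ j) (neg_mem (one_mem _)) hneg fun j => by
    rw [map_mul, map_pow, map_pow, map_neg, map_one, map_inv₀, ← mul_pow, mul_neg_one, inv_neg,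
      neg_one_mul]
  have hmain := hx.listsOrbits_map h2 hτ hs hr (I := Finset.Ico 1 (2 ^ (M - 1)))
    (α := fun i => k * δ ^ i) (b := b) (fun i _ => mul_mem hkF (pow_mem hδF i))
    (fun i _ => hvalz _ (hδ1 i)) (hns.imp_right fun h i _ => h _ (hδ1 i))
    (fun i hi j hj h => by
      rw [Finset.mem_Ico] at hi hj
      rw [hτα] at h
      have h' : δ ^ (i + j) = 1 := by
        rw [pow_add, ← mul_left_cancel₀ hk0 h, inv_pow, mul_inv_cancel₀ (pow_ne_zero _ hδ0)]
      have := Nat.le_of_dvd (by omega) (hδ.dvd_of_pow_eq_one _ h')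
      omega)
    (fun i hi j hj h => by
      rw [Finset.mem_Ico] at hi hj
      exact hδ.pow_inj (by omega) (by omega) (mul_left_cancel₀ hk0 h))
    (c := c) (fun i j => by
      rw [hc, hτα, mul_inv, mul_inv, mul_pow, mul_pow, ← mul_add, inv_pow δ i, inv_inv, ← pow_mul,
        ← inv_pow δ i, ← pow_mul, add_comm])
  refine ((h1.listsOrbits_singleton.add h3.listsOrbits_singleton ?_).add hmain ?_).congr rfl
    fun ψ => ?_
  · rw [Set.disjoint_left]
    intro ψ h h'
    exact neg_one_ne_one h2 (mul_left_cancel₀ hk0 (h'.symm.trans h))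
  · rw [Set.disjoint_left]
    -- `± κ` are the powers of `δ` with exponents `0` and `2 ^ (M - 1)`, outside the range of `i`
    have hne : ∀ i ∈ Finset.Ico 1 (2 ^ (M - 1)), ∀ z, (z = 1 ∨ z = -1) →
        k * z ≠ k * δ ^ i ∧ k * z ≠ k * δ⁻¹ ^ i := by
      intro i hi z hz
      rw [Finset.mem_Ico] at hi
      have hz' : z⁻¹ = z := by rcases hz with rfl | rfl <;> simp [inv_neg]
      have key : z ≠ δ ^ i := by
        rintro rfl
        rcases hz with h | h
        · exact absurd (hδ.pow_inj (by omega) (by omega) (h.trans (pow_zero δ).symm)) (by omega)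
        · exact absurd (hδ.pow_inj (by omega) (by omega) (h.trans hhalf.symm)) (by omega)
      refine ⟨fun h => key (mul_left_cancel₀ hk0 h), fun h => key ?_⟩
      have h' := mul_left_cancel₀ hk0 h
      rw [← hz', h', inv_pow, inv_inv]
    rintro ψ (h | h) ⟨i, hi, h' | h'⟩
    · exact (hne i hi 1 (Or.inl rfl)).1 (h.symm.trans h')
    · exact (hne i hi 1 (Or.inl rfl)).2 (h.symm.trans (h'.trans (hτα i)))
    · exact (hne i hi (-1) (Or.inr rfl)).1 (h.symm.trans h')
    · exact (hne i hi (-1) (Or.inr rfl)).2 (h.symm.trans (h'.trans (hτα i)))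
  · simp only [Set.mem_union, Set.mem_ofPred_eq, hτα]
    generalize ψ (scaledPow b x (n - s) r) = v
    have hv : ∀ z, v = k * z ↔ k⁻¹ * v = z := fun z => by rw [inv_mul_eq_iff_eq_mul₀ hk0]
    simp only [hv]
    generalize k⁻¹ * v = w
    constructor
    · rintro ((rfl | rfl) | ⟨i, -, rfl | rfl⟩)
      · exact one_pow _
      · exact hneg
      · exact hδ1 i
      · rw [inv_pow, inv_pow, hδ1, inv_one]
    · intro hw
      have : NeZero (2 ^ M) := ⟨by positivity⟩
      obtain ⟨i, hi, rfl⟩ := hδ.eq_pow_of_pow_eq_one hw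
      rcases Nat.eq_zero_or_pos i with rfl | hi0
      · exact Or.inl (Or.inl (pow_zero δ))
      rcases lt_trichotomy i (2 ^ (M - 1)) with h | rfl | h
      · exact Or.inr ⟨i, Finset.mem_Ico.2 ⟨hi0, h⟩, Or.inl rfl⟩
      · exact Or.inl (Or.inr hhalf)
      · refine Or.inr ⟨2 ^ M - i, Finset.mem_Ico.2 ⟨by omega, by omega⟩, Or.inr ?_⟩
        rw [inv_pow]
        refine eq_inv_of_mul_eq_one_left ?_
        rw [← pow_add, Nat.add_sub_cancel' hi.le, hδ.pow_eq_one]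

/-! ### The order of a root of unity -/

theorem pow_two_pow_of_le {z : AlgebraicClosure K} {t t' : ℕ} (h : z ^ 2 ^ t = 1) (htt : t ≤ t') :
    z ^ 2 ^ t' = 1 := by
  rw [← Nat.add_sub_cancel' htt, pow_add, pow_mul, h, one_pow]

theorem lt_of_pow_two_pow (h2 : (2 : K) ≠ 0) {z : AlgebraicClosure K} {t t' : ℕ}
    (h : z ^ 2 ^ t = -1) (h' : z ^ 2 ^ t' = 1) : t < t' := by
  by_contra! hle
  exact neg_one_ne_one h2 (h.symm.trans (pow_two_pow_of_le h' hle))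

theorem pow_two_pow_succ {z : AlgebraicClosure K} {t : ℕ} (h : z ^ 2 ^ t = -1) :
    z ^ 2 ^ (t + 1) = 1 := by
  rw [pow_succ, pow_mul, h, neg_one_sq]

theorem eq_of_pow_two_pow (h2 : (2 : K) ≠ 0) {z : AlgebraicClosure K} {t t' : ℕ}
    (h : z ^ 2 ^ t = -1) (h' : z ^ 2 ^ t' = -1) : t = t' := by
  have h1 := lt_of_pow_two_pow h2 h (pow_two_pow_succ h')
  have h3 := lt_of_pow_two_pow h2 h' (pow_two_pow_succ h)
  omega

theorem exists_pow_two_pow_eq_neg_one {z : AlgebraicClosure K} {t s : ℕ}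
    (h : z ^ 2 ^ s = 1) : z ^ 2 ^ t = 1 ∨ ∃ r, t ≤ r ∧ r < s ∧ z ^ 2 ^ r = -1 := by
  induction s with
  | zero => exact Or.inl (pow_two_pow_of_le h (Nat.zero_le t))
  | succ s ih =>
    rcases le_or_gt (s + 1) t with hle | hlt
    · exact Or.inl (pow_two_pow_of_le h hle)
    rw [pow_succ, pow_mul] at h
    rcases mul_self_eq_one_iff.1 ((sq _).symm.trans h) with h | h
    · exact (ih h).imp_right fun ⟨r, h1, h2, h3⟩ => ⟨r, h1, by omega, h3⟩
    · exact Or.inr ⟨s, by omega, by omega, h⟩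

end Families

/-! ### The lists of minimal idempotents -/

section Lists

variable {K A : Type*} [Field K] [Ring A] [Algebra K A]
  {ε : ℕ → AlgebraicClosure K} {τ : AlgebraicClosure K ≃ₐ[K] AlgebraicClosure K}
  {x : A} {n s r m : ℕ} {a b : Kˣ}

theorem IsQuadraticConj.map_eq_neg_of_sq {ι : AlgebraicClosure K} (hτ : IsQuadraticConj ι τ)
    {y : AlgebraicClosure K} (hy : y ^ 2 = -1) : τ y = -y := by
  have hyF : y ∈ K⟮ι⟯ := by
    rcases sq_eq_sq_iff_eq_or_eq_neg.1 (hy.trans hτ.sq.symm) with rfl | rfl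
    · exact mem_adjoin_simple_self K y
    · exact neg_mem (mem_adjoin_simple_self K ι)
  have h : τ y ^ 2 = y ^ 2 := by rw [← map_pow, hy, map_neg, map_one]
  exact (sq_eq_sq_iff_eq_or_eq_neg.1 h).resolve_left fun h => hτ.ne_of_sq hy (hτ.inBase y hyF h)

theorem map_eq_typeSign (hε : ∀ k, IsPrimitiveRoot (ε k) (2 ^ k))
    (hτ : IsQuadraticConj (ε 2) τ) (h : IsTypeE ε m ∨ InvertsRootsOfUnity (ε 2) τ m) :
    ε m ∈ K⟮ε 2⟯ ∧ τ (ε m) = typeSign ε m * (ε m)⁻¹ := by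
  by_cases hE : IsTypeE ε m
  · rw [typeSign, if_pos hE, neg_one_mul]
    exact hE.map_eq hε hτ
  · rw [typeSign, if_neg hE, one_mul]
    exact h.resolve_left hE (ε m) (hε m).pow_eq_one

/-- The primitive roots of unity of order `2 ^ M`, multiplied by a constant `κ`: conjugation
interchanges those whose power with exponent `2 ^ (M - 2)` is one and the other of the square roots
of `-1`. -/
theorem IsPureGenerator.listsOrbits_primitive (h2 : (2 : K) ≠ 0)
    (hx : IsPureGenerator x (2 ^ n) (a : K)) (hτ : IsQuadraticConj (ε 2) τ)
    (hs : HeightEq ε n a s) (hr : r ≤ s) {M : ℕ} (hM1 : 2 ≤ M) (hM : M - 2 ≤ s - r)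
    {κ ζ δ : AlgebraicClosure K} (hζ : IsPrimitiveRoot ζ (2 ^ M))
    (hδ : IsPrimitiveRoot δ (2 ^ (M - 2))) (hκF : κ ∈ K⟮ε 2⟯) (hζF : ζ ∈ K⟮ε 2⟯)
    (hδF : δ ∈ K⟮ε 2⟯) (hκ : τ κ ^ 2 ^ (M - 2) = κ ^ 2 ^ (M - 2))
    (hval : algebraMap K _ (b : K) ^ 2 ^ s * (κ * ζ) ^ 2 ^ (s - r) = algebraMap K _ (a : K))
    (hns : r = 0 ∨ ∀ z, z ^ 2 ^ (M - 1) = -1 → ∀ y ∈ K⟮ε 2⟯, y ^ 2 ≠ κ * z) {c : ℕ → ℕ → K}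
    (hc : ∀ i j, algebraMap K _ (c i j) =
      (κ * ζ * δ ^ i)⁻¹ ^ j + (τ (κ * ζ * δ ^ i))⁻¹ ^ j) :
    ListsOrbits
      ((Finset.range (2 ^ (M - 2))).val.map
        fun i => dyadicMean (s - r) (c i) (scaledPow b x (n - s) r))
      {ψ : A →ₐ[K] AlgebraicClosure K |
        (κ⁻¹ * ψ (scaledPow b x (n - s) r)) ^ 2 ^ (M - 1) = -1} := by
  have hM' : M - 2 + 1 = M - 1 := by omega
  have hhalf : ζ ^ 2 ^ (M - 1) = -1 := hζ.pow_two_pow_pred (by omega)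
  have hsq : (ζ ^ 2 ^ (M - 2)) ^ 2 = -1 := by rw [← pow_mul, ← pow_succ, hM', hhalf]
  refine (hx.listsOrbits_coset h2 hτ hs hr hM hδ (mul_mem hκF hζF) hδF ?_ hval
    (hns.imp_right fun h z hz => ?_) hc).congr rfl fun ψ => ?_
  · rw [map_mul, mul_pow, mul_pow, hκ, ← map_pow τ ζ, hτ.map_eq_neg_of_sq hsq, mul_neg]
  · rw [mul_assoc]
    exact h _ (by rw [mul_pow, hhalf, ← hM', pow_succ, pow_mul z, hz, one_pow, mul_one])
  · simp only [Set.mem_ofPred_eq]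
    rw [hM', mul_inv_rev, mul_assoc, mul_pow, inv_pow, hhalf, inv_neg, inv_one, neg_one_mul,
      neg_eq_iff_eq_neg]

theorem coeff_eq_of_map_eq {ζ δ lam : AlgebraicClosure K} (hζ : τ ζ = lam * ζ⁻¹)
    (hδ : τ δ = δ⁻¹) (i j : ℕ) :
    (1 * ζ * δ ^ i)⁻¹ ^ j + (τ (1 * ζ * δ ^ i))⁻¹ ^ j =
      ζ⁻¹ ^ j * δ⁻¹ ^ (i * j) + lam⁻¹ ^ j * ζ ^ j * δ ^ (i * j) := by
  rw [one_mul, map_mul, map_pow, hζ, hδ]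
  simp only [mul_inv, mul_pow, inv_inv, inv_pow, ← pow_mul]

theorem IsPureGenerator.listsMinimalIdempotents_one (h2 : (2 : K) ≠ 0)
    (hx : IsPureGenerator x (2 ^ n) (a : K)) (hτ : IsQuadraticConj (ε 2) τ)
    (hs : HeightEq ε n a 0) : ListsMinimalIdempotents ({1} : Multiset A) := by
  -- for `s = 0` and `b = a` the element `a⁻¹ * x ^ (2 ^ n) = 1` has the single value `1`
  have h := hx.isOrbitIndicator_single h2 hτ.sq hs le_rfl (one_mem K⟮ε 2⟯) (b := a) (by simp)
    (Or.inl rfl) (c := fun _ => 1) (by simp)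
  refine (h.listsOrbits_singleton.congr (by simp [dyadicMean]) fun ψ => ?_).listsMinimalIdempotents
    hx.separates
  have hψ := hx.mul_scaledPow_pow hs.le le_rfl (b := a) ψ
  simpa using hψ

theorem IsPureGenerator.listsMinimalIdempotents_roots (h2 : (2 : K) ≠ 0)
    (hx : IsPureGenerator x (2 ^ n) (a : K)) (hε : ∀ k, IsPrimitiveRoot (ε k) (2 ^ k))
    (hτ : IsQuadraticConj (ε 2) τ) (hs : HeightEq ε n a s) (hs1 : 1 ≤ s)
    (hinv : InvertsRootsOfUnity (ε 2) τ s) (hab : a = b ^ 2 ^ s) :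
    ∃ c : ℕ → ℕ → K,
      (∀ i j, algebraMap K (AlgebraicClosure K) (c i j) =
        ε s ^ (i * j) + (ε s)⁻¹ ^ (i * j)) ∧
      ListsMinimalIdempotents
        ({dyadicMean s (fun _ => (1 : K)) (scaledPow b x (n - s) 0),
          dyadicMean s (fun j => (-1 : K) ^ j) (scaledPow b x (n - s) 0)} +
        (Finset.Ico 1 (2 ^ (s - 1))).val.map
          (fun i => dyadicMean s (c i) (scaledPow b x (n - s) 0))) := by
  have ha : algebraMap K (AlgebraicClosure K) (a : K) = algebraMap K _ (b : K) ^ 2 ^ s := by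
    simp [hab]
  have hb : algebraMap K (AlgebraicClosure K) (b : K) ≠ 0 := by simp
  obtain ⟨hF, hτε⟩ := hinv (ε s) (hε s).pow_eq_one
  obtain ⟨c, hc⟩ := hτ.exists_coeff (α := fun i => ε s ^ i) fun i => pow_mem hF i
  have hc' : ∀ i j, algebraMap K (AlgebraicClosure K) (c i j) =
      ε s ^ (i * j) + (ε s)⁻¹ ^ (i * j) := fun i j => by
    rw [hc, map_pow, hτε]
    simp only [inv_pow, inv_inv, ← pow_mul]
    rw [add_comm]
  refine ⟨c, hc', ?_⟩
  have h := hx.listsOrbits_roots h2 hτ hs (Nat.zero_le s) hs1 le_rfl (hε s) hinv (κ := 1)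
    (b := b) (by simp [ha]) (Or.inl rfl) (c := c) (by simpa using hc')
  refine (h.congr (by simp) fun ψ => ?_).listsMinimalIdempotents hx.separates
  have hψ := hx.mul_scaledPow_pow hs.le (Nat.zero_le s) (b := b) ψ
  rw [ha, mul_eq_left₀ (pow_ne_zero _ hb)] at hψ
  simpa using hψ

/-- If `a = -b ^ (2 ^ s)`, then the values of `u_0` are the primitive roots of unity of order
`2 ^ (s + 1)`. -/
theorem IsPureGenerator.listsMinimalIdempotents_neg (h2 : (2 : K) ≠ 0)
    (hx : IsPureGenerator x (2 ^ n) (a : K)) (hε : ∀ k, IsPrimitiveRoot (ε k) (2 ^ k))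
    (hτ : IsQuadraticConj (ε 2) τ) (hs : HeightEq ε n a s) (hs1 : 1 ≤ s)
    (hinv : InvertsRootsOfUnity (ε 2) τ s)
    (hinv' : IsTypeE ε (s + 1) ∨ InvertsRootsOfUnity (ε 2) τ (s + 1)) (hab : a = -b ^ 2 ^ s) :
    ∃ c : ℕ → ℕ → K,
      (∀ i j, algebraMap K (AlgebraicClosure K) (c i j) =
        (ε (s + 1))⁻¹ ^ j * (ε (s - 1))⁻¹ ^ (i * j) +
          (typeSign ε (s + 1))⁻¹ ^ j * ε (s + 1) ^ j * ε (s - 1) ^ (i * j)) ∧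
      ListsMinimalIdempotents
        ((Finset.range (2 ^ (s - 1))).val.map
          (fun i => dyadicMean s (c i) (scaledPow b x (n - s) 0))) := by
  have ha : algebraMap K (AlgebraicClosure K) (a : K) = -algebraMap K _ (b : K) ^ 2 ^ s := by
    simp [hab]
  have hb : algebraMap K (AlgebraicClosure K) (b : K) ≠ 0 := by simp
  obtain ⟨hF, hτε⟩ := map_eq_typeSign hε hτ hinv'
  obtain ⟨hF', hτε'⟩ := hinv.mono (Nat.sub_le s 1) (ε (s - 1)) (hε (s - 1)).pow_eq_one
  obtain ⟨c, hc⟩ := hτ.exists_coeff (α := fun i => 1 * ε (s + 1) * ε (s - 1) ^ i)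
    fun i => mul_mem (mul_mem (one_mem _) hF) (pow_mem hF' i)
  refine ⟨c, fun i j => (hc i j).trans (coeff_eq_of_map_eq hτε hτε' i j), ?_⟩
  have hhalf := (hε (s + 1)).pow_two_pow_pred (Nat.le_add_left 1 s)
  have h := hx.listsOrbits_primitive h2 hτ hs (Nat.zero_le s) (M := s + 1) (by omega) (by omega)
    (hε (s + 1)) (hε (s - 1)) (one_mem _) hF hF' (by simp) (b := b)
    (by rw [one_mul, ha]; exact (congrArg _ hhalf).trans (by ring)) (Or.inl rfl) hc
  refine (h.congr rfl fun ψ => ?_).listsMinimalIdempotents hx.separates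
  have hψ := hx.mul_scaledPow_pow hs.le (Nat.zero_le s) (b := b) ψ
  rw [ha, ← mul_neg_one, mul_right_inj' (pow_ne_zero _ hb)] at hψ
  simpa using hψ

/-- The value of `u_0` runs over the roots of unity of order dividing `2 ^ s`. Those of order
dividing `2 ^ (m - 1)` are treated directly; for those of order `2 ^ (m + r)` one passes to the
value of `u_r`, which has order `2 ^ m` and is a nonsquare. -/
theorem IsPureGenerator.listsMinimalIdempotents_towers (h2 : (2 : K) ≠ 0)
    (hx : IsPureGenerator x (2 ^ n) (a : K)) (hε : ∀ k, IsPrimitiveRoot (ε k) (2 ^ k))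
    (hτ : IsQuadraticConj (ε 2) τ) (hs : HeightEq ε n a s) (hm : 2 ≤ m)
    (hinv : InvertsRootsOfUnity (ε 2) τ (m - 1))
    (hinv' : IsTypeE ε m ∨ InvertsRootsOfUnity (ε 2) τ m)
    (hnsq : PrimitiveRootsNonsquare (ε 2) m) (hms : m ≤ s) (hab : a = b ^ 2 ^ s) :
    ∃ c d : ℕ → ℕ → K,
      (∀ i j, algebraMap K (AlgebraicClosure K) (c i j) =
        ε (m - 1) ^ (i * j) + (ε (m - 1))⁻¹ ^ (i * j)) ∧
      (∀ i j, algebraMap K (AlgebraicClosure K) (d i j) =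
        (ε m)⁻¹ ^ j * (ε (m - 2))⁻¹ ^ (i * j) +
          (typeSign ε m)⁻¹ ^ j * ε m ^ j * ε (m - 2) ^ (i * j)) ∧
      ListsMinimalIdempotents
        ({dyadicMean s (fun _ => (1 : K)) (scaledPow b x (n - s) 0),
          dyadicMean s (fun j => (-1 : K) ^ j) (scaledPow b x (n - s) 0)} +
        (Finset.Ico 1 (2 ^ (m - 2))).val.map
          (fun i => dyadicMean s (c i) (scaledPow b x (n - s) 0)) +
        (Finset.Icc 0 (s - m)).val.bind
          (fun r => (Finset.range (2 ^ (m - 2))).val.map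
            (fun i => dyadicMean (s - r) (d i) (scaledPow b x (n - s) r)))) := by
  have ha : algebraMap K (AlgebraicClosure K) (a : K) = algebraMap K _ (b : K) ^ 2 ^ s := by
    simp [hab]
  have hb : algebraMap K (AlgebraicClosure K) (b : K) ≠ 0 := by simp
  obtain ⟨hF1, hτ1⟩ := hinv (ε (m - 1)) (hε _).pow_eq_one
  obtain ⟨hF2, hτ2⟩ := hinv.mono (by omega : m - 2 ≤ m - 1) (ε (m - 2)) (hε _).pow_eq_one
  obtain ⟨hF, hτε⟩ := map_eq_typeSign hε hτ hinv'
  obtain ⟨c, hc⟩ := hτ.exists_coeff (α := fun i => ε (m - 1) ^ i) fun i => pow_mem hF1 i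
  have hc' : ∀ i j, algebraMap K (AlgebraicClosure K) (c i j) =
      ε (m - 1) ^ (i * j) + (ε (m - 1))⁻¹ ^ (i * j) := fun i j => by
    rw [hc, map_pow, hτ1]
    simp only [inv_pow, inv_inv, ← pow_mul]
    rw [add_comm]
  obtain ⟨d, hd⟩ := hτ.exists_coeff (α := fun i => 1 * ε m * ε (m - 2) ^ i)
    fun i => mul_mem (mul_mem (one_mem _) hF) (pow_mem hF2 i)
  refine ⟨c, d, hc', fun i j => (hd i j).trans (coeff_eq_of_map_eq hτε hτ2 i j), ?_⟩
  have hroots := hx.listsOrbits_roots h2 hτ hs (Nat.zero_le s) (M := m - 1) (by omega) (by omega)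
    (hε (m - 1)) hinv (κ := 1) (b := b) (by simp [ha]) (Or.inl rfl) (c := c) (by simpa using hc')
  have hprim : ∀ r ∈ Finset.Icc 0 (s - m), ListsOrbits
      ((Finset.range (2 ^ (m - 2))).val.map
        (fun i => dyadicMean (s - r) (d i) (scaledPow b x (n - s) r)))
      {ψ : A →ₐ[K] AlgebraicClosure K |
        ψ (scaledPow b x (n - s) 0) ^ 2 ^ (r + (m - 1)) = -1} := fun r hr => by
    have hrs := (Finset.mem_Icc.1 hr).2
    refine (hx.listsOrbits_primitive h2 hτ hs (by omega) (M := m) hm (by omega) (hε m)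
      (hε (m - 2)) (one_mem _) hF hF2 (by simp) (b := b) ?_
      (Or.inr fun z hz => by simpa using hnsq z hz) hd).congr rfl fun ψ => ?_
    · rw [one_mul, pow_two_pow_of_le (hε m).pow_eq_one (by omega), mul_one, ha]
    · simp only [Set.mem_ofPred_eq]
      rw [inv_one, one_mul, map_scaledPow_eq_pow, ← pow_mul, ← pow_add]
  have hbind := ListsOrbits.bind hprim fun i _ j _ hij => by
    rw [Set.disjoint_left]
    intro ψ h h'
    have := eq_of_pow_two_pow h2 h h'
    omega
  refine ((hroots.add hbind ?_).congr (by simp [Nat.sub_sub]) fun ψ => ?_).listsMinimalIdempotents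
    hx.separates
  · rw [Set.disjoint_left]
    rintro ψ h ⟨r, -, h'⟩
    rw [Set.mem_ofPred_eq, map_one, inv_one, one_mul] at h
    have := lt_of_pow_two_pow h2 h' h
    omega
  · have hψ := hx.mul_scaledPow_pow hs.le (Nat.zero_le s) (b := b) ψ
    rw [ha, mul_eq_left₀ (pow_ne_zero _ hb), Nat.sub_zero] at hψ
    simp only [Set.mem_union, Set.mem_ofPred_eq, map_one, inv_one, one_mul, Set.mem_univ, iff_true]
    refine (exists_pow_two_pow_eq_neg_one hψ).imp_right fun ⟨t, ht1, ht2, ht⟩ => ?_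
    exact ⟨t - (m - 1), Finset.mem_Icc.2 ⟨Nat.zero_le _, by omega⟩,
      by rwa [Nat.sub_add_cancel ht1]⟩

end Lists

/-! ### Fields of type D with a constant term outside the powers of `K` -/

section TypeD

variable {K A : Type*} [Field K] [Ring A] [Algebra K A]
  {ε : ℕ → AlgebraicClosure K} {τ : AlgebraicClosure K ≃ₐ[K] AlgebraicClosure K}
  {x : A} {n s r m : ℕ} {a b : Kˣ}

theorem IsTypeD.map_one_add (hε : ∀ k, IsPrimitiveRoot (ε k) (2 ^ k))
    (hτ : IsQuadraticConj (ε 2) τ) (hD : IsTypeD ε m) :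
    τ (1 + ε m) = (1 + ε m) * (ε m)⁻¹ := by
  have he0 : ε m ≠ 0 := (hε m).ne_zero (by positivity)
  rw [map_add, map_one, (hD.invertsRootsOfUnity hε hτ _ (hε m).pow_eq_one).2, add_mul, one_mul,
    mul_inv_cancel₀ he0, add_comm]

/-- If `a = b ^ (2 ^ s) * (1 + ε m) ^ (2 ^ s)`, then `b⁻¹ * x ^ (2 ^ (n - s))` takes values
`(1 + ε m) * η` with `η ^ 2 ^ s = 1`. The orbits listed here are those with `η` in `K(ε 2)`, that
is, `η ^ 2 ^ m = 1`. -/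
theorem IsPureGenerator.listsOrbits_one_add (h2 : (2 : K) ≠ 0)
    (hx : IsPureGenerator x (2 ^ n) (a : K)) (hε : ∀ k, IsPrimitiveRoot (ε k) (2 ^ k))
    (hτ : IsQuadraticConj (ε 2) τ) (hs : HeightEq ε n a s) (hD : IsTypeD ε m) (hms : m ≤ s)
    (hab : algebraMap K (AlgebraicClosure K) (a : K) =
      algebraMap K (AlgebraicClosure K) (b : K) ^ 2 ^ s * (1 + ε m) ^ 2 ^ s) :
    ∃ c : ℕ → ℕ → K,
      (∀ i j, algebraMap K (AlgebraicClosure K) (c i j) =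
        (1 + ε m)⁻¹ ^ j * ((ε (m - 1))⁻¹ ^ (i * j) + ε m ^ j * ε (m - 1) ^ (i * j))) ∧
      ListsOrbits
        ((Finset.range (2 ^ (m - 1))).val.map
          (fun i => dyadicMean s (c i) (scaledPow b x (n - s) 0)))
        {ψ : A →ₐ[K] AlgebraicClosure K |
          ((1 + ε m)⁻¹ * ψ (scaledPow b x (n - s) 0)) ^ 2 ^ m = 1} := by
  have hm := hD.2.1
  have hinv := hD.invertsRootsOfUnity hε hτ
  have hF := (hinv (ε m) (hε m).pow_eq_one).1
  obtain ⟨hF1, hτ1⟩ := hinv.mono (Nat.sub_le m 1) (ε (m - 1)) (hε _).pow_eq_one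
  have hθF : 1 + ε m ∈ K⟮ε 2⟯ := add_mem (one_mem _) hF
  have hτθ := hD.map_one_add hε hτ
  obtain ⟨c, hc⟩ := hτ.exists_coeff (α := fun i => (1 + ε m) * ε (m - 1) ^ i)
    fun i => mul_mem hθF (pow_mem hF1 i)
  refine ⟨c, fun i j => ?_, ?_⟩
  · rw [hc, map_mul, map_pow, hτθ, hτ1]
    simp only [mul_inv, mul_pow, inv_inv, inv_pow, ← pow_mul]
    ring
  · refine (hx.listsOrbits_coset h2 hτ hs (Nat.zero_le s) (N := m - 1) (by omega) (hε (m - 1)) hθF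
      hF1 ?_ hab.symm (Or.inl rfl) hc).congr rfl fun ψ => ?_
    · rw [hτθ, mul_pow, inv_pow, (hε m).pow_two_pow_pred (by omega), inv_neg, inv_one, mul_neg_one]
    · rw [Nat.sub_add_cancel (by omega : 1 ≤ m)]

/-- The orbits where `b⁻¹ * x ^ (2 ^ (n - s))` takes a value `(1 + ε m) * η` with `η` of order
`2 ^ (m + 1)`: the square of such a value is the product of `q = (1 + ε m) ^ 2 / ε m`, which is in
`K`, and a root of unity of order dividing `2 ^ (m - 1)`. -/
theorem IsPureGenerator.listsOrbits_one_add_sq (h2 : (2 : K) ≠ 0)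
    (hx : IsPureGenerator x (2 ^ n) (a : K)) (hε : ∀ k, IsPrimitiveRoot (ε k) (2 ^ k))
    (hτ : IsQuadraticConj (ε 2) τ) (hs : HeightEq ε n a s) (hD : IsTypeD ε m)
    (hab : algebraMap K (AlgebraicClosure K) (a : K) =
      algebraMap K (AlgebraicClosure K) (b : K) ^ 2 ^ s * (1 + ε m) ^ 2 ^ s)
    {q : K} (hq : algebraMap K (AlgebraicClosure K) q = 2 + ε m + (ε m)⁻¹) :
    ∃ d : ℕ → ℕ → K,
      (∀ i j, algebraMap K (AlgebraicClosure K) (d i j) =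
        (2 + ε m + (ε m)⁻¹)⁻¹ ^ j *
          ((ε (m - 1))⁻¹ ^ (j * (1 + i)) + ε (m - 1) ^ (j * (1 + i)))) ∧
      ListsOrbits
        (if m + 1 ≤ s then
          {dyadicMean (s - 1) (fun j => q⁻¹ ^ j) (scaledPow b x (n - s) 1),
           dyadicMean (s - 1) (fun j => (-1) ^ j * q⁻¹ ^ j) (scaledPow b x (n - s) 1)} +
          (Finset.range (2 ^ (m - 2) - 1)).val.map
            (fun i => dyadicMean (s - 1) (d i) (scaledPow b x (n - s) 1))
         else 0)
        {ψ : A →ₐ[K] AlgebraicClosure K | m + 1 ≤ s ∧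
          ((1 + ε m)⁻¹ * ψ (scaledPow b x (n - s) 0)) ^ 2 ^ m = -1} := by
  have hm := hD.2.1
  have he0 : ε m ≠ 0 := (hε m).ne_zero (by positivity)
  have hinv := hD.invertsRootsOfUnity hε hτ
  have hF := (hinv (ε m) (hε m).pow_eq_one).1
  have hinv1 := hinv.mono (Nat.sub_le m 1)
  obtain ⟨hF1, hτ1⟩ := hinv1 (ε (m - 1)) (hε _).pow_eq_one
  have hhalf := (hε m).pow_two_pow_pred (by omega : 1 ≤ m)
  have hθF : 1 + ε m ∈ K⟮ε 2⟯ := add_mem (one_mem _) hF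
  have hθ0 : 1 + ε m ≠ 0 := by
    intro h
    rw [h, zero_pow (by positivity), mul_zero] at hab
    exact absurd hab (by simp)
  have hqθ : algebraMap K (AlgebraicClosure K) q = (1 + ε m) ^ 2 * (ε m)⁻¹ := by
    rw [hq]
    field_simp
    ring
  obtain ⟨d, hd⟩ := hτ.exists_coeff (α := fun i => algebraMap K _ q * ε (m - 1) ^ i)
    fun i => mul_mem (_root_.algebraMap_mem _ q) (pow_mem hF1 i)
  have hd' : ∀ i j, algebraMap K (AlgebraicClosure K) (d i j) =
      (algebraMap K _ q)⁻¹ ^ j * (ε (m - 1) ^ (i * j) + (ε (m - 1))⁻¹ ^ (i * j)) := fun i j => by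
    rw [hd, map_mul, map_pow, hτ1, AlgEquiv.commutes]
    simp only [mul_inv, mul_pow, inv_inv, inv_pow, ← pow_mul]
    ring
  refine ⟨fun i => d (1 + i), fun i j => ?_, ?_⟩
  · rw [hd', hq, mul_comm j, add_comm (ε (m - 1) ^ _)]
  split_ifs with hms
  · have hroots := hx.listsOrbits_roots h2 hτ hs (r := 1) (by omega) (M := m - 1) (by omega)
      (by omega) (hε (m - 1)) hinv1 (κ := q) (b := b) ?_ (Or.inr ?_) hd'
    · refine hroots.congr ?_ fun ψ => ?_
      · congr 1
        have hIco : Finset.Ico 1 (2 ^ (m - 1 - 1)) =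
            (Finset.range (2 ^ (m - 2) - 1)).map (addLeftEmbedding 1) := by
          rw [Finset.range_eq_Ico, Finset.map_add_left_Ico, add_zero, Nat.sub_sub,
            Nat.add_sub_cancel' Nat.one_le_two_pow]
        rw [hIco, Finset.map_val, Multiset.map_map]
        rfl
      · simp only [Set.mem_ofPred_eq]
        have hη : (algebraMap K _ q)⁻¹ * ψ (scaledPow b x (n - s) 1) =
            ((1 + ε m)⁻¹ * ψ (scaledPow b x (n - s) 0)) ^ 2 * ε m := by
          rw [hqθ, map_scaledPow_eq_pow, pow_one, mul_inv, inv_inv, ← inv_pow]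
          ring
        rw [hη, mul_pow, hhalf, ← pow_mul, ← pow_succ', Nat.sub_add_cancel (by omega : 1 ≤ m),
          mul_neg_one, neg_eq_iff_eq_neg, and_iff_right hms]
    · rw [hqθ, mul_pow, inv_pow, pow_two_pow_of_le (hε m).pow_eq_one (by omega), inv_one, mul_one,
        ← pow_mul, ← pow_succ', Nat.sub_add_cancel (by omega : 1 ≤ s), hab]
    -- `z` is a square in `K(ε 2)` and `q` is a square times the nonsquare `(ε m)⁻¹`
    · intro z hz y hy hyz
      obtain ⟨w, rfl⟩ := IsAlgClosed.exists_pow_nat_eq z two_pos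
      rw [← pow_mul, ← pow_succ', Nat.sub_add_cancel (by omega : 1 ≤ m)] at hz
      have hw0 : w ≠ 0 := by
        rintro rfl
        rw [zero_pow (by positivity)] at hz
        exact zero_ne_one hz
      refine hD.primitiveRootsNonsquare h2 hε hτ (ε m)⁻¹ (by rw [inv_pow, hhalf, inv_neg, inv_one])
        (y / ((1 + ε m) * w)) (div_mem hy (mul_mem hθF (hinv w hz).1)) ?_
      rw [div_pow, hyz, hqθ]
      field_simp
  · exact listsOrbits_zero_empty.congr rfl fun ψ => by simp [hms]

/-- The orbits where `b⁻¹ * x ^ (2 ^ (n - s))` takes a value `(1 + ε m) * η` with `η` of order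
`2 ^ (m + r)`, `r ≥ 2`; then `η ^ 2 ^ r` is a primitive root of order `2 ^ m`. Conjugation sends
`(1 + ε m) ^ (2 ^ r)` to its multiple by `(ε m) ^ (-2 ^ r)`, and this factor is a power of
`ε (m - 2) = ε m ^ 4`. -/
theorem IsPureGenerator.listsOrbits_one_add_pow (h2 : (2 : K) ≠ 0)
    (hx : IsPureGenerator x (2 ^ n) (a : K)) (hε : ∀ k, IsPrimitiveRoot (ε k) (2 ^ k))
    (hτ : IsQuadraticConj (ε 2) τ) (hs : HeightEq ε n a s) (hD : IsTypeD ε m)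
    (hab : algebraMap K (AlgebraicClosure K) (a : K) =
      algebraMap K (AlgebraicClosure K) (b : K) ^ 2 ^ s * (1 + ε m) ^ 2 ^ s)
    (hε4 : ε (m - 2) = ε m ^ 4) (hr2 : 2 ≤ r) (hrs : r + m ≤ s) :
    ∃ f : ℕ → ℕ → K,
      (∀ i j, algebraMap K (AlgebraicClosure K) (f i j) =
        (1 + ε m)⁻¹ ^ (j * 2 ^ r) *
          ((ε m)⁻¹ ^ j * (ε (m - 2))⁻¹ ^ (i * j) +
            ε m ^ j * ε (m - 2) ^ (j * (i + 2 ^ (r - 2))))) ∧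
      ListsOrbits
        ((Finset.range (2 ^ (m - 2))).val.map
          (fun i => dyadicMean (s - r) (f i) (scaledPow b x (n - s) r)))
        {ψ : A →ₐ[K] AlgebraicClosure K |
          ((1 + ε m)⁻¹ * ψ (scaledPow b x (n - s) 0)) ^ 2 ^ (r + (m - 1)) = -1} := by
  have hm := hD.2.1
  have hinv := hD.invertsRootsOfUnity hε hτ
  obtain ⟨hF, hτε⟩ := hinv (ε m) (hε m).pow_eq_one
  obtain ⟨hF2, hτ2⟩ := hinv.mono (Nat.sub_le m 2) (ε (m - 2)) (hε _).pow_eq_one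
  have hθF : 1 + ε m ∈ K⟮ε 2⟯ := add_mem (one_mem _) hF
  have hθ0 : 1 + ε m ≠ 0 := by
    intro h
    rw [h, zero_pow (by positivity), mul_zero] at hab
    exact absurd hab (by simp)
  have hτκ : τ ((1 + ε m) ^ 2 ^ r) = (1 + ε m) ^ 2 ^ r * (ε (m - 2))⁻¹ ^ 2 ^ (r - 2) := by
    rw [map_pow, hD.map_one_add hε hτ, mul_pow, inv_pow, inv_pow, hε4, ← pow_mul (ε m) 4,
      show 4 * 2 ^ (r - 2) = 2 ^ r by
        rw [show 4 = 2 ^ 2 by norm_num, ← pow_add, Nat.add_sub_cancel' hr2]]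
  obtain ⟨f, hf⟩ := hτ.exists_coeff (α := fun i => (1 + ε m) ^ 2 ^ r * ε m * ε (m - 2) ^ i)
    fun i => mul_mem (mul_mem (pow_mem hθF _) hF) (pow_mem hF2 i)
  refine ⟨f, fun i j => ?_, ?_⟩
  · rw [hf, map_mul, map_mul, map_pow τ (ε (m - 2)), hτκ, hτ2, hτε]
    simp only [mul_inv, mul_pow, inv_inv, inv_pow, ← pow_mul]
    rw [mul_comm j (2 ^ r), mul_comm j (i + _), add_mul, pow_add]
    ring
  · refine (hx.listsOrbits_primitive h2 hτ hs (by omega) hm (by omega) (hε m) (hε (m - 2))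
      (pow_mem hθF (2 ^ r)) hF hF2 ?_ (b := b) ?_ (Or.inr fun z hz y hy hyz => ?_) hf).congr rfl
      fun ψ => ?_
    · rw [hτκ, mul_pow, inv_pow, inv_pow, pow_right_comm (ε (m - 2)), (hε (m - 2)).pow_eq_one,
        one_pow, inv_one, mul_one]
    · rw [mul_pow, pow_two_pow_of_le (hε m).pow_eq_one (by omega), mul_one, ← pow_mul, ← pow_add,
        Nat.add_sub_cancel' (by omega), hab]
    · refine hD.primitiveRootsNonsquare h2 hε hτ z hz (y / (1 + ε m) ^ 2 ^ (r - 1))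
        (div_mem hy (pow_mem hθF _)) ?_
      rw [div_pow, hyz, ← pow_mul, ← pow_succ, Nat.sub_add_cancel (by omega),
        mul_div_cancel_left₀ _ (pow_ne_zero _ hθ0)]
    · simp only [Set.mem_ofPred_eq]
      rw [map_scaledPow_eq_pow, ← inv_pow, ← mul_pow, ← pow_mul, ← pow_add]

theorem IsPureGenerator.listsMinimalIdempotents_one_add (h2 : (2 : K) ≠ 0)
    (hx : IsPureGenerator x (2 ^ n) (a : K)) (hε : ∀ k, IsPrimitiveRoot (ε k) (2 ^ k))
    (hτ : IsQuadraticConj (ε 2) τ) (hs : HeightEq ε n a s) (hD : IsTypeD ε m) (hms : m ≤ s)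
    (hε4 : m + 2 ≤ s → ε (m - 2) = ε m ^ 4)
    (hab : algebraMap K (AlgebraicClosure K) (a : K) =
      algebraMap K (AlgebraicClosure K) (b : K) ^ 2 ^ s * (1 + ε m) ^ 2 ^ s) :
    ∃ (q : K) (c d : ℕ → ℕ → K) (f : ℕ → ℕ → ℕ → K),
      algebraMap K (AlgebraicClosure K) q = 2 + ε m + (ε m)⁻¹ ∧
      (∀ i j, algebraMap K (AlgebraicClosure K) (c i j) =
        (1 + ε m)⁻¹ ^ j *
          ((ε (m - 1))⁻¹ ^ (i * j) + ε m ^ j * ε (m - 1) ^ (i * j))) ∧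
      (∀ i j, algebraMap K (AlgebraicClosure K) (d i j) =
        (2 + ε m + (ε m)⁻¹)⁻¹ ^ j *
          ((ε (m - 1))⁻¹ ^ (j * (1 + i)) + ε (m - 1) ^ (j * (1 + i)))) ∧
      (∀ r ∈ Finset.Icc 2 (s - m), ∀ i j,
        algebraMap K (AlgebraicClosure K) (f r i j) =
        (1 + ε m)⁻¹ ^ (j * 2 ^ r) *
          ((ε m)⁻¹ ^ j * (ε (m - 2))⁻¹ ^ (i * j) +
            ε m ^ j * ε (m - 2) ^ (j * (i + 2 ^ (r - 2))))) ∧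
      ListsMinimalIdempotents
        ((Finset.range (2 ^ (m - 1))).val.map
          (fun i => dyadicMean s (c i) (scaledPow b x (n - s) 0)) +
        (if m + 1 ≤ s then
          {dyadicMean (s - 1) (fun j => q⁻¹ ^ j) (scaledPow b x (n - s) 1),
           dyadicMean (s - 1) (fun j => (-1) ^ j * q⁻¹ ^ j) (scaledPow b x (n - s) 1)} +
          (Finset.range (2 ^ (m - 2) - 1)).val.map
            (fun i => dyadicMean (s - 1) (d i) (scaledPow b x (n - s) 1))
         else 0) +
        (Finset.Icc 2 (s - m)).val.bind
          (fun r => (Finset.range (2 ^ (m - 2))).val.map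
            (fun i => dyadicMean (s - r) (f r i) (scaledPow b x (n - s) r)))) := by
  have hm := hD.2.1
  have hb : algebraMap K (AlgebraicClosure K) (b : K) ≠ 0 := by simp
  have hθ0 : 1 + ε m ≠ 0 := by
    intro h
    rw [h, zero_pow (by positivity), mul_zero] at hab
    exact absurd hab (by simp)
  obtain ⟨t, ht⟩ := hD.2.2.1
  have hq : algebraMap K (AlgebraicClosure K) (2 + t) = 2 + ε m + (ε m)⁻¹ := by
    rw [map_add, ht, map_ofNat, add_assoc]
  obtain ⟨c, hc, hc'⟩ := hx.listsOrbits_one_add h2 hε hτ hs hD hms hab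
  obtain ⟨d, hd, hd'⟩ := hx.listsOrbits_one_add_sq h2 hε hτ hs hD hab hq
  have hex := fun (r : ℕ) (hr : r ∈ Finset.Icc 2 (s - m)) =>
    have hr' := Finset.mem_Icc.1 hr
    hx.listsOrbits_one_add_pow h2 hε hτ hs hD hab (hε4 (by omega)) (r := r) hr'.1 (by omega)
  have hex' : ∀ r, ∃ f : ℕ → ℕ → K, r ∈ Finset.Icc 2 (s - m) → _ := fun r => by
    by_cases hr : r ∈ Finset.Icc 2 (s - m)
    · obtain ⟨f, hf⟩ := hex r hr
      exact ⟨f, fun _ => hf⟩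
    · exact ⟨fun _ _ => 0, fun h => absurd h hr⟩
  choose f hf using hex'
  refine ⟨2 + t, c, d, f, hq, hc, hd, fun r hr => (hf r hr).1, ?_⟩
  have hbind := ListsOrbits.bind (fun r hr => (hf r hr).2) fun i _ j _ hij => by
    rw [Set.disjoint_left]
    intro ψ h h'
    have := eq_of_pow_two_pow h2 h h'
    omega
  refine (((hc'.add hd' ?_).add hbind ?_).congr rfl fun ψ => ?_).listsMinimalIdempotents
    hx.separates
  · rw [Set.disjoint_left]
    rintro ψ h ⟨-, h'⟩
    exact neg_one_ne_one h2 (h'.symm.trans h)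
  · rw [Set.disjoint_left]
    rintro ψ (h | ⟨-, h⟩) ⟨r, hr, h'⟩
    · have := lt_of_pow_two_pow h2 h' h
      have := Finset.mem_Icc.1 hr
      omega
    · have := eq_of_pow_two_pow h2 h' h
      have := Finset.mem_Icc.1 hr
      omega
  · have hψ := hx.mul_scaledPow_pow hs.le (Nat.zero_le s) (b := b) ψ
    rw [hab, mul_right_inj' (pow_ne_zero _ hb), Nat.sub_zero] at hψ
    have hη : ((1 + ε m)⁻¹ * ψ (scaledPow b x (n - s) 0)) ^ 2 ^ s = 1 := by
      rw [mul_pow, hψ, inv_pow, inv_mul_cancel₀ (pow_ne_zero _ hθ0)]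
    simp only [Set.mem_union, Set.mem_ofPred_eq, Set.mem_univ, iff_true]
    rcases exists_pow_two_pow_eq_neg_one (t := m) hη with h | ⟨t, ht1, ht2, ht⟩
    · exact Or.inl (Or.inl h)
    rcases ht1.eq_or_lt with rfl | hlt
    · exact Or.inl (Or.inr ⟨ht2, ht⟩)
    · exact Or.inr ⟨t - (m - 1), Finset.mem_Icc.2 ⟨by omega, by omega⟩,
        by rwa [Nat.sub_add_cancel (by omega)]⟩

end TypeD

/-! ### Twisted group algebras of cyclic `2`-groups -/

theorem theorem3 {K G A : Type*} [Field K] [Group G] [Ring A] [Algebra K A]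
    (h2 : (2 : K) ≠ 0)
    (ε : ℕ → AlgebraicClosure K) (hε : ∀ k, IsPrimitiveRoot (ε k) (2 ^ k))
    (hK : K⟮ε 2⟯ ≠ ⊥)
    (n : ℕ) (g : G) (hg : ∀ x : G, x ∈ Subgroup.zpowers g) (hG : Nat.card G = 2 ^ n)
    (T : TwistedGroupAlgebra K G A)
    (a : Kˣ) (ha : T.bar g ^ 2 ^ n = algebraMap K A (a : K))
    (s : ℕ) (hs : HeightEq ε n a s) :
    -- 1)
    (s = 0 → ListsMinimalIdempotents ({1} : Multiset A)) ∧
    -- 2)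
    (1 ≤ s → (IsTypeC ε ∨ ∃ m, (IsTypeD ε m ∨ IsTypeE ε m) ∧ s ≤ m - 1) →
      ∀ b : Kˣ, a = b ^ 2 ^ s →
      ∃ c : ℕ → ℕ → K,
        (∀ i j, algebraMap K (AlgebraicClosure K) (c i j) =
          ε s ^ (i * j) + (ε s)⁻¹ ^ (i * j)) ∧
        ListsMinimalIdempotents
          ({dyadicMean s (fun _ => (1 : K)) (scaledPow b (T.bar g) (n - s) 0),
            dyadicMean s (fun j => (-1 : K) ^ j) (scaledPow b (T.bar g) (n - s) 0)} +
          (Finset.Ico 1 (2 ^ (s - 1))).val.map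
            (fun i => dyadicMean s (c i) (scaledPow b (T.bar g) (n - s) 0)))) ∧
    -- 3)
    (∀ m, (IsTypeD ε m ∨ IsTypeE ε m) → m ≤ s →
      ∀ b : Kˣ, a = b ^ 2 ^ s →
      ∃ c d : ℕ → ℕ → K,
        (∀ i j, algebraMap K (AlgebraicClosure K) (c i j) =
          ε (m - 1) ^ (i * j) + (ε (m - 1))⁻¹ ^ (i * j)) ∧
        (∀ i j, algebraMap K (AlgebraicClosure K) (d i j) =
          (ε m)⁻¹ ^ j * (ε (m - 2))⁻¹ ^ (i * j) +
            (typeSign ε m)⁻¹ ^ j * ε m ^ j * ε (m - 2) ^ (i * j)) ∧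
        ListsMinimalIdempotents
          ({dyadicMean s (fun _ => (1 : K)) (scaledPow b (T.bar g) (n - s) 0),
            dyadicMean s (fun j => (-1 : K) ^ j) (scaledPow b (T.bar g) (n - s) 0)} +
          (Finset.Ico 1 (2 ^ (m - 2))).val.map
            (fun i => dyadicMean s (c i) (scaledPow b (T.bar g) (n - s) 0)) +
          (Finset.Icc 0 (s - m)).val.bind
            (fun r => (Finset.range (2 ^ (m - 2))).val.map
              (fun i => dyadicMean (s - r) (d i) (scaledPow b (T.bar g) (n - s) r))))) ∧
    -- 4); the sign is `-1` exactly if `K` is of type E with constant `m = s + 1`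
    (1 ≤ s → (IsTypeC ε ∨ ∃ m, (IsTypeD ε m ∨ IsTypeE ε m) ∧ s ≤ m - 1) →
      ∀ b : Kˣ, a = -b ^ 2 ^ s →
      ∃ c : ℕ → ℕ → K,
        (∀ i j, algebraMap K (AlgebraicClosure K) (c i j) =
          (ε (s + 1))⁻¹ ^ j * (ε (s - 1))⁻¹ ^ (i * j) +
            (typeSign ε (s + 1))⁻¹ ^ j * ε (s + 1) ^ j * ε (s - 1) ^ (i * j)) ∧
        ListsMinimalIdempotents
          ((Finset.range (2 ^ (s - 1))).val.map
            (fun i => dyadicMean s (c i) (scaledPow b (T.bar g) (n - s) 0)))) ∧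
    -- 5)
    (∀ m, IsTypeD ε m → m ≤ s → (m + 2 ≤ s → ε (m - 2) = ε m ^ 4) →
      ∀ b : Kˣ, algebraMap K (AlgebraicClosure K) (a : K) =
          algebraMap K (AlgebraicClosure K) (b : K) ^ 2 ^ s * (1 + ε m) ^ 2 ^ s →
      ∃ (q : K) (c d : ℕ → ℕ → K) (f : ℕ → ℕ → ℕ → K),
        algebraMap K (AlgebraicClosure K) q = 2 + ε m + (ε m)⁻¹ ∧
        (∀ i j, algebraMap K (AlgebraicClosure K) (c i j) =
          (1 + ε m)⁻¹ ^ j *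
            ((ε (m - 1))⁻¹ ^ (i * j) + ε m ^ j * ε (m - 1) ^ (i * j))) ∧
        (∀ i j, algebraMap K (AlgebraicClosure K) (d i j) =
          (2 + ε m + (ε m)⁻¹)⁻¹ ^ j *
            ((ε (m - 1))⁻¹ ^ (j * (1 + i)) + ε (m - 1) ^ (j * (1 + i)))) ∧
        (∀ r ∈ Finset.Icc 2 (s - m), ∀ i j,
          algebraMap K (AlgebraicClosure K) (f r i j) =
          (1 + ε m)⁻¹ ^ (j * 2 ^ r) *
            ((ε m)⁻¹ ^ j * (ε (m - 2))⁻¹ ^ (i * j) +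
              ε m ^ j * ε (m - 2) ^ (j * (i + 2 ^ (r - 2))))) ∧
        ListsMinimalIdempotents
          ((Finset.range (2 ^ (m - 1))).val.map
            (fun i => dyadicMean s (c i) (scaledPow b (T.bar g) (n - s) 0)) +
          (if m + 1 ≤ s then
            {dyadicMean (s - 1) (fun j => q⁻¹ ^ j) (scaledPow b (T.bar g) (n - s) 1),
             dyadicMean (s - 1) (fun j => (-1) ^ j * q⁻¹ ^ j)
               (scaledPow b (T.bar g) (n - s) 1)} +
            (Finset.range (2 ^ (m - 2) - 1)).val.map
              (fun i => dyadicMean (s - 1) (d i) (scaledPow b (T.bar g) (n - s) 1))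
           else 0) +
          (Finset.Icc 2 (s - m)).val.bind
            (fun r => (Finset.range (2 ^ (m - 2))).val.map
              (fun i => dyadicMean (s - r) (f r i) (scaledPow b (T.bar g) (n - s) r))))) := by
  have hε2 : ε 2 ^ 2 = -1 := (hε 2).pow_two_pow_pred one_le_two
  obtain ⟨τ, hτ⟩ := exists_isQuadraticConj h2 hε2 hK
  obtain ⟨pb, hgen, hdim⟩ := T.exists_powerBasis hg (by positivity) hG ha
  have hx : IsPureGenerator (T.bar g) (2 ^ n) (a : K) := by
    rw [← hgen] at ha ⊢
    exact pb.isPureGenerator (by push_cast; exact pow_ne_zero n h2) a.ne_zero hdim ha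
  have hinv : ∀ t, (IsTypeC ε ∨ ∃ m, (IsTypeD ε m ∨ IsTypeE ε m) ∧ t ≤ m - 1) →
      InvertsRootsOfUnity (ε 2) τ t := by
    rintro t (hC | ⟨m, hD | hE, hm⟩)
    · exact hC.invertsRootsOfUnity hε hτ t
    · exact (hD.invertsRootsOfUnity hε hτ).mono (by omega)
    · exact (hE.invertsRootsOfUnity hε hτ).mono hm
  refine ⟨?_, fun hs1 hty b hab => ?_, fun m hty hms b hab => ?_, fun hs1 hty b hab => ?_,
    fun m hD hms hε4 b hab => ?_⟩
  · rintro rfl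
    exact hx.listsMinimalIdempotents_one h2 hτ hs
  · exact hx.listsMinimalIdempotents_roots h2 hε hτ hs hs1 (hinv s hty) hab
  · have hm : 2 ≤ m := by
      rcases hty with hD | hE
      · exact hD.2.1
      · exact le_trans (by norm_num) hE.2.1
    refine hx.listsMinimalIdempotents_towers h2 hε hτ hs hm
      (hinv _ (Or.inr ⟨m, hty, le_rfl⟩)) ?_ ?_ hms hab
    · exact hty.symm.imp_right fun hD => hD.invertsRootsOfUnity hε hτ
    · rcases hty with hD | hE
      · exact hD.primitiveRootsNonsquare h2 hε hτ
      · exact hE.primitiveRootsNonsquare h2 hε hτ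
  · refine hx.listsMinimalIdempotents_neg h2 hε hτ hs hs1 (hinv s hty) ?_ hab
    rcases hty with hC | ⟨m, hD | hE, hm⟩
    · exact Or.inr (hC.invertsRootsOfUnity hε hτ _)
    · exact Or.inr ((hD.invertsRootsOfUnity hε hτ).mono (by omega))
    · rcases hm.eq_or_lt with rfl | hlt
      · left
        rwa [Nat.sub_add_cancel (by have := hE.2.1; omega)]
      · exact Or.inr ((hE.invertsRootsOfUnity hε hτ).mono hlt)
  · exact hx.listsMinimalIdempotents_one_add h2 hε hτ hs hD hms hε4 hab
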